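/- **Theorem (information propagation speed).** Fix $\lambda,v,r,\tau,K,P_t,P_{\min},\delta>0$ and $0<P_{out}<1$: traffic intensity in each direction of a highway, vehicle speed, single-vehicle transmission range, retransmission period, Rician factor, transmit power, minimum received power, path-loss exponent, target outage probability. Put $\sigma=\sqrt{1/K}$, $V_1=\frac{4\sigma^2(\sigma^2+1)}{9(2\sigma^2+1)^2}$, $M_1=1-V_1$, $V_2=V_1/2$, $M_2=1-V_2$, let $\Phi$ be the standard normal distribution function, assume $\sqrt{V_1}\,\Phi^{-1}(P_{out})+M_1>0$, and let $$F_0(n)=\left[\frac{2\big(\sqrt{V_2}\,\Phi^{-1}(P_{out}^{1/n})+M_2\big)^3}{\big(\sqrt{V_1}\,\Phi^{-1}(P_{out})+M_1\big)^3}\right]^{1/\delta},\qquad n\ge 1,$$ be the transmission range gain of the cooperative scheme towards a cluster of $n$ vehicles. Then $F_0$ is positive, nondecreasing and unbounded. Moreover, the following holds for $F=F_0$, and more generally for every positive, nondecreasing, unbounded $F$ on $\{1,2,\dots\}$. *Model.* The size $N$ of a cluster is the index of the first spacing larger than $r$ in a sequence of i.i.d. $\mathrm{Exp}(\lambda)$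 car spacings. Distances between clusters are $\mathrm{Exp}(\lambda)$ and independent of the sizes. Information (observed relative to the eastbound cars) passes through cycles, each of which consists of a waiting phase of duration $T_w$ and a forwarding phase of duration $T_t$ in which the distance $D$ is covered. - *Distance.* Successive gaps are independent. Each has a length $I\sim\mathrm{Exp}(\lambda)$, an eastbound cluster size $n_e$, a westbound cluster size $n_w$ and a fair coin, all independent; it is bridged if $I<rF(n_e)$, respectively (according to the coin) if $I<r(F(n_w)+F(n_e))$. $D$ is the length of a gap, conditioned not to be bridged, plus the lengths of the bridged gaps that follow it before the next gap that is not bridged. - *Waiting.* $2vT_w=G_e+I_w+B(G_e)$, with $G_e$, $I_w$ and the random function $B$ independent. The law of $G_e$ is the mixture over $n$, with the weights $P(N=n)$, of the $\mathrm{Exp}(\lambda)$ law conditioned to exceed $rF(n)$; $I_w\sim\mathrm{Exp}(\lambda)$; and $B(x)$ is the distance from an initial westbound cluster to the first westbound cluster (possibly the initial one) whose size $M$ satisfies $x<r(F(N_r)+F(M))$, where the receiving cluster size $N_r$ and the westbound sizes are i.i.d. copies of $N$ and consecutive westbound clusters are at independent $\mathrm{Exp}(\lambda)$ distances. - *Transmission.*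 $T_t$ is $\tau$ times the total number of attempts over one or two hops (probability $1/2$ each). The attempts of a hop are repeated until the first success, and different attempts are independent. An attempt has an independent receiving cluster size $N_r$, distance $I\sim\mathrm{Exp}(\lambda)$ and fading; it is in outage if for every receiver $k\le N_r$ one has $P_0I^{-\delta}(|\psi_{k1}|^2+|\psi_{k2}|^2)<P_{\min}$, where $P_0=\frac{KP_t}{K+1}$, $\psi_{ki}=1+\sigma g_{ki}$ and the $g_{ki}\sim\mathcal{CN}(0,1)$ are independent. Let $(T_{w,i},T_{t,i},D_i)_{i\ge0}$ be i.i.d. triples with these marginal laws (the dependence within a triple is arbitrary). Expectations are taken in $[0,\infty]$ and $a/\infty=0$. Then the following hold. 1. With $P_N(k)=e^{-\lambda r}(1-e^{-\lambda r})^{k-1}$, $E(D)=\frac{1}{\lambda(1-P_b)}<\infty$, where $$P_b=\tfrac12\sum_{n_e\ge1}(1-e^{-\lambda rF(n_e)})P_N(n_e)+\tfrac12\sum_{n_w\ge1}\sum_{n_e\ge1}(1-e^{-\lambda r(F(n_w)+F(n_e))})P_N(n_w)P_N(n_e).$$ 2. $2v\,E(T_w)=E(G_e)+\frac1\lambda+\int_0^\infty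 E(B(x))\,p_e(x)\,dx$, where $$E(G_e)=\sum_{k\ge1}\frac{(1-e^{-\lambda r})^{k-1}\int_{rF(k)}^\infty x\lambda e^{-\lambda x}dx}{e^{-\lambda r(F(k)-1)}},\qquad p_e(x)=\sum_{k\ge1}P_N(k)\,\frac{\lambda e^{-\lambda x}}{e^{-\lambda rF(k)}}\mathbf 1_{\{x\ge rF(k)\}},$$ $$E(B(x))=\sum_{k=1}^{k_0}\frac{P_N(k)}{\lambda}\Big((1-e^{-\lambda r})^{-G(k,x)}-1\Big),\quad k_0=\lfloor F^{-1}(x/r)\rfloor,\quad G(k,x)=\lfloor F^{-1}(x/r-F(k))\rfloor,$$ and $\lfloor F^{-1}(y)\rfloor$ denotes the largest $n\ge1$ with $F(n)\le y$, or $0$ if there is none. 3. $E(T_t)=\frac{3\tau}{2}\cdot\frac{1}{1-\sum_{k\ge1}P_N(k)E(P_o|_{N_r=k})}<\infty$, where $E(P_o|_{N_r=k})=\int_0^\infty P\big(P_0x^{-\delta}(|\psi_1|^2+|\psi_2|^2)<P_{\min}\big)^k\lambda e^{-\lambda x}dx$, with $\psi_1,\psi_2$ independent copies of $\psi_{11}$.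 4. The information propagation speed is, almost surely, $$v_p=\lim_{t\to\infty}\frac{X(t)}{t}=\frac{E(D)}{E(T_w)+E(T_t)},$$ for every trajectory $X$ which starts at $0$ at time $0$, stays put during each waiting phase, and during the forwarding phase of the $i$-th cycle moves in an arbitrary manner between its position at the beginning of that cycle and the position $D_i$ further on, which it has at the end of the cycle. -/

import Mathlib

open MeasureTheory ProbabilityTheory Filter Topology
open scoped ENNReal NNReal

noncomputable section

namespace HighwayIPS

/-- The numerical parameters of the highway and of the radio channel. -/
structure Highway where
  /-- traffic intensity of either direction (vehicles per unit length) -/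
  lam : ℝ
  /-- common speed of the vehicles; the two directions approach each other at speed `2 v` -/
  v : ℝ
  /-- transmission range of a single vehicle -/
  r : ℝ
  /-- retransmission period -/
  tau : ℝ
  /-- Rician factor -/
  K : ℝ
  /-- transmit power of one vehicle -/
  Pt : ℝ
  /-- minimum received power -/
  Pmin : ℝ
  /-- path loss exponent -/
  del : ℝ
  /-- target outage probability -/
  Pout : ℝ

/-! ### The transmission range gain of the cooperative scheme -/

/-- The quantile function `Φ⁻¹` of the standard normal distribution (used on `(0, 1)`). -/
def normalQuantile (p : ℝ) : ℝ := sInf {x : ℝ | p ≤ cdf (gaussianReal 0 1) x}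

/-- The standard deviation `σ = √(1 / K)` of the scattered component. -/
def Highway.sigma (h : Highway) : ℝ := Real.sqrt (1 / h.K)

def Highway.V1 (h : Highway) : ℝ :=
  4 * h.sigma ^ 2 * (h.sigma ^ 2 + 1) / (9 * (2 * h.sigma ^ 2 + 1) ^ 2)

def Highway.M1 (h : Highway) : ℝ :=
  1 - 4 * h.sigma ^ 2 * (h.sigma ^ 2 + 1) / (9 * (2 * h.sigma ^ 2 + 1) ^ 2)

def Highway.V2 (h : Highway) : ℝ :=
  2 * h.sigma ^ 2 * (h.sigma ^ 2 + 1) / (9 * (2 * h.sigma ^ 2 + 1) ^ 2)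

def Highway.M2 (h : Highway) : ℝ :=
  1 - 2 * h.sigma ^ 2 * (h.sigma ^ 2 + 1) / (9 * (2 * h.sigma ^ 2 + 1) ^ 2)

/-- The transmission range gain `F(n)` when the receiving cluster has `n ≥ 1` vehicles: two
cooperating vehicles reach a cluster of `n` vehicles over the distance `r F(n)`. -/
def Highway.rangeGain (h : Highway) (n : ℕ) : ℝ :=
  (2 * (Real.sqrt h.V2 * normalQuantile (h.Pout ^ (1 / (n : ℝ))) + h.M2) ^ 3 /
    (Real.sqrt h.V1 * normalQuantile h.Pout + h.M1) ^ 3) ^ (1 / h.del)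

/-- Positive, nondecreasing and unbounded functions of the cluster size `n ≥ 1`. -/
structure IsGainFunction (F : ℕ → ℝ) : Prop where
  pos : ∀ n, 1 ≤ n → 0 < F n
  mono : ∀ m n, 1 ≤ m → m ≤ n → F m ≤ F n
  unbounded : Tendsto F atTop atTop

/-! ### Clusters -/

/-- The number of vehicles of a cluster whose successive car spacings are `s 0, s 1, …`: the
cluster ends at the first spacing that exceeds `r`. -/
def clusterSize (r : ℝ) (s : ℕ → ℝ) : ℕ := sInf {k : ℕ | r < s k} + 1

/-- The law of the size of a cluster in Poisson traffic (i.i.d. exponential car spacings). -/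
def Highway.sizeLaw (h : Highway) : Measure ℕ :=
  (Measure.infinitePi fun _ : ℕ => expMeasure h.lam).map (clusterSize h.r)

/-- The distribution `P_N(k) = e^{-λ r} (1 - e^{-λ r})^{k - 1}`, for `k ≥ 1`. -/
def Highway.PN (h : Highway) (k : ℕ) : ℝ :=
  Real.exp (-h.lam * h.r) * (1 - Real.exp (-h.lam * h.r)) ^ (k - 1)

/-! ### The forwarding phase: distance travelled from one block to the next -/

/-- The data attached to an eastbound gap. -/
structure GapData where
  /-- length of the gap -/
  len : ℝ
  /-- size of the eastbound receiving cluster -/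
  ne : ℕ
  /-- size of the westbound cluster that may relay -/
  nw : ℕ
  /-- whether a westbound cluster is available as a relay -/
  relay : Bool

/-- A gap is bridged if it is shorter than the range to the eastbound cluster, respectively, when a
westbound cluster can relay, than the sum of the two ranges. -/
def GapData.Bridged (r : ℝ) (F : ℕ → ℝ) (g : GapData) : Prop :=
  if g.relay then g.len < r * (F g.nw + F g.ne) else g.len < r * F g.ne

/-- The gap data with the given components. -/
def GapData.ofProd (q : ℝ × ℕ × ℕ × Bool) : GapData := ⟨q.1, q.2.1, q.2.2.1, q.2.2.2⟩

/-- The law of a gap: an exponential length, two cluster sizes, and a fair coin deciding whether a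
relay is available, all independent. -/
def Highway.gapLaw (h : Highway) : Measure (ℝ × ℕ × ℕ × Bool) :=
  (expMeasure h.lam).prod (h.sizeLaw.prod (h.sizeLaw.prod (PMF.uniformOfFintype Bool).toMeasure))

/-- The distance from one block to the next: the blocking gap, of index `0`, and the bridged gaps
that follow it, up to the next gap that is not bridged. -/
def forwardDistance (r : ℝ) (F : ℕ → ℝ) (g : ℕ → ℝ × ℕ × ℕ × Bool) : ℝ :=
  ∑ j ∈ Finset.range (sInf {j : ℕ | 1 ≤ j ∧ ¬ (GapData.ofProd (g j)).Bridged r F}), (g j).1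

/-- The law of the distance `D` of a cycle: successive gaps are independent, and the gap of index
`0` is conditioned not to be bridged. -/
def Highway.distanceLaw (h : Highway) (F : ℕ → ℝ) : Measure ℝ :=
  (ProbabilityTheory.cond (Measure.infinitePi fun _ : ℕ => h.gapLaw)
    {g | ¬ (GapData.ofProd (g 0)).Bridged h.r F}).map (forwardDistance h.r F)

/-- The probability `P_b` that a gap can be bridged. -/
def Highway.Pb (h : Highway) (F : ℕ → ℝ) : ℝ :=
  1 / 2 * ∑' n : ℕ, (1 - Real.exp (-h.lam * h.r * F (n + 1))) * h.PN (n + 1)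
    + 1 / 2 * ∑' m : ℕ, ∑' n : ℕ,
      (1 - Real.exp (-h.lam * h.r * (F (m + 1) + F (n + 1)))) * h.PN (m + 1) * h.PN (n + 1)

/-- The formula for `E(D)`. -/
def Highway.meanDistance (h : Highway) (F : ℕ → ℝ) : ℝ := 1 / (h.lam * (1 - h.Pb F))

/-! ### The waiting phase -/

/-- The law of the length `G_e` of an unbridged gap: a receiving cluster of size `n` is drawn, and
the exponential gap is conditioned to exceed the range `r F(n)`. -/
def Highway.unbridgedGapLaw (h : Highway) (F : ℕ → ℝ) : Measure ℝ :=
  h.sizeLaw.bind fun n => ProbabilityTheory.cond (expMeasure h.lam) (Set.Ioi (h.r * F n))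

/-- The distance `B(x)` from an arbitrary westbound cluster, of index `0`, to the first one ahead
that bridges a gap of length `x` in front of an eastbound cluster of size `n`. Here `(w j).1` is the
size of the westbound cluster of index `j` and `(w j).2` its distance to the next one. -/
def bridgeRoad (r : ℝ) (F : ℕ → ℝ) (n : ℕ) (w : ℕ → ℕ × ℝ) (x : ℝ) : ℝ :=
  ∑ j ∈ Finset.range (sInf {j : ℕ | x < r * (F n + F (w j).1)}), (w j).2

/-- The law of the blocking time `T_w`, determined by `2 v T_w = G_e + I_w + B(G_e)`, where `I_w`
is the exponential distance from the gap to the first westbound cluster, and `G_e`, `I_w` and the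
random function `B` are independent. -/
def Highway.waitLaw (h : Highway) (F : ℕ → ℝ) : Measure ℝ :=
  ((h.unbridgedGapLaw F).prod ((expMeasure h.lam).prod (h.sizeLaw.prod
      (Measure.infinitePi fun _ : ℕ => h.sizeLaw.prod (expMeasure h.lam))))).map
    fun q => (q.1 + q.2.1 + bridgeRoad h.r F q.2.2.1 q.2.2.2 q.1) / (2 * h.v)

/-- `⌊F⁻¹(y)⌋`: the largest `n ≥ 1` with `F(n) ≤ y`, and `0` if there is none. -/
def floorInv (F : ℕ → ℝ) (y : ℝ) : ℕ := sSup {n : ℕ | 1 ≤ n ∧ F n ≤ y}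

/-- The formula for `E(B(x))`, with `G(k, x) = ⌊F⁻¹(x / r - F(k))⌋` and `k₀ = ⌊F⁻¹(x / r)⌋`. -/
def Highway.meanBridgeRoad (h : Highway) (F : ℕ → ℝ) (x : ℝ) : ℝ :=
  ∑ k ∈ Finset.Icc 1 (floorInv F (x / h.r)), h.PN k / h.lam *
    (((1 - Real.exp (-h.lam * h.r)) ^ floorInv F (x / h.r - F k))⁻¹ - 1)

/-- The formula for `E(G_e)`, as an element of `[0, ∞]`. -/
def Highway.meanGap (h : Highway) (F : ℕ → ℝ) : ℝ≥0∞ :=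
  ∑' k : ℕ, ENNReal.ofReal ((1 - Real.exp (-h.lam * h.r)) ^ k) *
    (∫⁻ x in Set.Ioi (h.r * F (k + 1)), ENNReal.ofReal (x * h.lam * Real.exp (-h.lam * x))) /
      ENNReal.ofReal (Real.exp (-h.lam * h.r * (F (k + 1) - 1)))

/-- The formula for the density `p_e` of `G_e`. -/
def Highway.gapDensity (h : Highway) (F : ℕ → ℝ) (x : ℝ) : ℝ≥0∞ :=
  ∑' k : ℕ, ENNReal.ofReal (h.PN (k + 1) *
    (if h.r * F (k + 1) ≤ x then
      h.lam * Real.exp (-h.lam * x) / Real.exp (-h.lam * h.r * F (k + 1)) else 0))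

/-- The formula for `E(T_w)`, as an element of `[0, ∞]`. -/
def Highway.meanWait (h : Highway) (F : ℕ → ℝ) : ℝ≥0∞ :=
  (h.meanGap F + ENNReal.ofReal (1 / h.lam) +
    ∫⁻ x in Set.Ioi (0 : ℝ), ENNReal.ofReal (h.meanBridgeRoad F x) * h.gapDensity F x) /
      ENNReal.ofReal (2 * h.v)

/-! ### The transmission time -/

/-- The law `𝒞𝒩(0, 1)`: independent centred Gaussian real and imaginary parts of variance `1/2`. -/
def complexGaussian : Measure ℂ :=
  ((gaussianReal 0 (1 / 2)).prod (gaussianReal 0 (1 / 2))).map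
    fun p => (p.1 : ℂ) + (p.2 : ℂ) * Complex.I

/-- The law of the pair of independent scattered components from the two transmitters to one
receiver. -/
def scatterLaw : Measure (ℂ × ℂ) := complexGaussian.prod complexGaussian

/-- The link to one receiver at distance `x` fails: `P₀ x^{-δ} (|ψ₁|² + |ψ₂|²) < P_min`, with
`P₀ = K P_t / (K + 1)` and `ψ_i = 1 + √(1/K) g_i`. -/
def Highway.LinkFails (h : Highway) (x : ℝ) (g : ℂ × ℂ) : Prop :=
  h.K * h.Pt / (h.K + 1) * x ^ (-h.del) *
    (‖1 + (h.sigma : ℂ) * g.1‖ ^ 2 + ‖1 + (h.sigma : ℂ) * g.2‖ ^ 2) < h.Pmin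

/-- The data of one transmission attempt: number of receivers, distance, and scattered components
at the successive receivers. -/
abbrev Attempt := ℕ × ℝ × (ℕ → ℂ × ℂ)

/-- The law of an attempt: cluster size, exponential distance and fading, all independent. -/
def Highway.attemptLaw (h : Highway) : Measure Attempt :=
  h.sizeLaw.prod ((expMeasure h.lam).prod (Measure.infinitePi fun _ : ℕ => scatterLaw))

/-- An attempt is in outage if the links to all the receivers fail (selection diversity). -/
def Highway.Outage (h : Highway) (a : Attempt) : Prop :=
  ∀ k < a.1, h.LinkFails a.2.1 (a.2.2 k)

/-- The number of attempts up to and including the first successful one. -/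
def Highway.numAttempts (h : Highway) (a : ℕ → Attempt) : ℕ := sInf {j : ℕ | ¬ h.Outage (a j)} + 1

/-- The law of the transmission time `T_t`: one or two hops with equal probability, each repeated
every `τ` units of time until it succeeds, with independent attempts. -/
def Highway.transmitLaw (h : Highway) : Measure ℝ :=
  ((PMF.uniformOfFintype Bool).toMeasure.prod
    ((Measure.infinitePi fun _ : ℕ => h.attemptLaw).prod
      (Measure.infinitePi fun _ : ℕ => h.attemptLaw))).map
    fun q => h.tau * ((h.numAttempts q.2.1 : ℝ) + if q.1 then (h.numAttempts q.2.2 : ℝ) else 0)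

/-- The outage probability of a hop over the distance `x` to a cluster of `k` vehicles. -/
def Highway.outageProb (h : Highway) (k : ℕ) (x : ℝ) : ℝ :=
  scatterLaw.real {g | h.LinkFails x g} ^ k

/-- `E(P_o | N_r = k)`: the outage probability averaged over an exponential distance. -/
def Highway.meanOutage (h : Highway) (k : ℕ) : ℝ := ∫ x, h.outageProb k x ∂(expMeasure h.lam)

/-- The formula for `E(T_t)`. -/
def Highway.meanTransmit (h : Highway) : ℝ :=
  3 * h.tau / 2 * (1 / (1 - ∑' k : ℕ, h.PN (k + 1) * h.meanOutage (k + 1)))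

/-! ### The renewal reward process -/

/-- `x t` is a possible position at time `t` (relative to the eastbound cars) of information that
passes through cycles of waiting times `Tw n`, transmission times `Tt n` and distances `D n`: it
stays put while waiting, and covers the distance `D n`, in an arbitrary manner, during the
forwarding phase of the cycle. -/
def IsPropagation (Tw Tt D : ℕ → ℝ) (x : ℝ → ℝ) : Prop :=
  ∀ n : ℕ, ∀ t : ℝ,
    let start : ℝ := ∑ i ∈ Finset.range n, (Tw i + Tt i)
    let done : ℝ := ∑ i ∈ Finset.range n, D i
    (start ≤ t → t ≤ start + Tw n → x t = done) ∧
    (start + Tw n ≤ t → t < start + Tw n + Tt n → done ≤ x t ∧ x t ≤ done + D n)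

/-- The information propagation speed `E(D) / (E(T_w) + E(T_t))`, in `[0, ∞]`. -/
def Highway.speed (h : Highway) (F : ℕ → ℝ) : ℝ≥0∞ :=
  ENNReal.ofReal (h.meanDistance F) / (h.meanWait F + ENNReal.ofReal h.meanTransmit)

end HighwayIPS

end

open HighwayIPS

open HighwayIPS

/-! All three means come from one fact about an i.i.d. sequence of law `ν`: if `A` has a complement
of positive mass, the sum of `f` over the terms before the first exit from `A` has mean `(∫ f over
A) / ν Aᶜ`. Writing the stopped sum as a series of products of indicators makes this a geometric
series (`lintegral_sum_range_sInf`). It is applied to eastbound gaps with `A` the bridged ones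
(`lintegral_distanceLaw`), to westbound clusters with `A` the too small ones
(`lintegral_bridgeRoad`), and to attempts with `A` the outages and `f = 1`
(`lintegral_numAttempts`). In each case the exit must have positive probability: an exponential
length exceeds every bound, the geometric size law has a positive tail, and at a short enough
distance a nonzero signal gets through.

The speed is a renewal reward limit. At time `t` in cycle `n`, the position lies between the total
distances of `n` and `n + 1` cycles, and `t` between the corresponding total durations; the strong
law for distances and durations squeezes `x t / t` (`IsPropagation.tendsto_div`). The durations may
have infinite mean because of the waiting time. Truncation then shows that their averages diverge
(`strong_law_ae_of_lintegral_eq_top`), so the speed is `0`, in agreement with `a / ∞ = 0`. Only the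
marginal means enter, so dependence within a triple plays no role.

That `rangeGain` is a gain function reduces to the normal quantile being monotone and divergent at
`1`, together with `V2 = V1 / 2`, which keeps the numerator positive (`isGainFunction_rangeGain`).
-/

/-! ### Stopping indices and sums stopped at the first exit of an i.i.d. sequence. -/

theorem measurable_sInf_setOf {α : Type*} [MeasurableSpace α] {p : ℕ → α → Prop}
    (hp : ∀ j, MeasurableSet {a | p j a}) : Measurable fun a => sInf {j | p j a} := by
  classical
  refine measurable_to_countable' fun n => ?_
  have hE : MeasurableSet {a | ∃ j, p j a} := by
    rw [Set.ofPred_exists]; exact MeasurableSet.iUnion hp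
  have hn : MeasurableSet {a | ∀ i < n, ¬ p i a} := by
    simp only [Set.ofPred_forall]
    exact MeasurableSet.iInter fun i => MeasurableSet.iInter fun _ => (hp i).compl
  -- Since `sInf ∅ = 0` in `ℕ`, the fibre over `0` also contains the points where no `p j` holds.
  have : (fun a => sInf {j | p j a}) ⁻¹' {n} =
      ({a | p n a} ∩ {a | ∀ i < n, ¬ p i a}) ∪ ({a | ∃ j, p j a}ᶜ ∩ {_a | n = 0}) := by
    ext a
    simp only [Set.mem_preimage, Set.mem_singleton_iff, Set.mem_union, Set.mem_inter_iff,
      Set.mem_ofPred_eq, Set.mem_compl_iff]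
    by_cases h : ∃ j, p j a
    · constructor
      · intro e
        refine Or.inl ⟨?_, fun i hi hpi => ?_⟩
        · rw [← e]; exact Nat.sInf_mem (s := {j | p j a}) h
        · rw [← e] at hi; exact Nat.notMem_of_lt_sInf hi hpi
      · rintro (⟨h1, h2⟩ | ⟨h1, -⟩)
        · refine le_antisymm (Nat.sInf_le h1) ?_
          by_contra hlt
          exact h2 _ (not_le.1 hlt) (Nat.sInf_mem (s := {j | p j a}) h)
        · exact absurd h h1
    · have he : {j | p j a} = ∅ := by
        ext j; simpa using fun hj => h ⟨j, hj⟩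
      simp only [he, Nat.sInf_empty, h, not_false_eq_true, true_and]
      constructor
      · intro e; exact Or.inr e.symm
      · rintro (⟨h1, -⟩ | h1)
        · exact absurd ⟨n, h1⟩ h
        · exact h1.symm
  rw [this]
  exact ((hp n).inter hn).union (hE.compl.inter (MeasurableSet.const _))

theorem Nat.lt_sInf_iff {s : Set ℕ} (hs : s.Nonempty) {j : ℕ} :
    j < sInf s ↔ ∀ i ≤ j, i ∉ s := by
  constructor
  · intro h i hi; exact Nat.notMem_of_lt_sInf (hi.trans_lt h)
  · intro h
    by_contra hlt
    exact h _ (not_lt.1 hlt) (Nat.sInf_mem hs)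

theorem measurable_sum_range {α : Type*} [MeasurableSpace α] {τ : α → ℕ} (hτ : Measurable τ)
    {f : ℕ → α → ℝ} (hf : ∀ i, Measurable (f i)) :
    Measurable fun a => ∑ j ∈ Finset.range (τ a), f j a := by
  have h : Measurable fun p : ℕ × α => ∑ j ∈ Finset.range p.1, f j p.2 :=
    measurable_from_prod_countable_right fun n => by
      exact Finset.measurable_sum (Finset.range n) fun i _ => hf i
  exact h.comp (hτ.prodMk measurable_id)

/-- Prepend a term to a sequence. -/
def seqCons {X : Type*} (p : X × (ℕ → X)) : ℕ → X
  | 0 => p.1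
  | n + 1 => p.2 n

@[simp] theorem seqCons_zero {X : Type*} (p : X × (ℕ → X)) : seqCons p 0 = p.1 := rfl

@[simp] theorem seqCons_succ {X : Type*} (p : X × (ℕ → X)) (n : ℕ) : seqCons p (n + 1) = p.2 n := rfl

-- The `j`-th term of the series survives exactly when `g 0, …, g j` all lie in `A`, that is, when
-- `j` precedes the exit. In this product form independence factors each expectation.
open Classical in
theorem sum_range_sInf_eq_tsum {X : Type*} {A : Set X} (f : X → ℝ≥0∞) {g : ℕ → X} (hg : ∃ j, g j ∉ A) :
    ∑ j ∈ Finset.range (sInf {j | g j ∉ A}), f (g j) =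
      ∑' j, (∏ i ∈ Finset.range j, A.indicator 1 (g i)) * A.indicator f (g j) := by
  rw [tsum_eq_sum (s := Finset.range (sInf {j | g j ∉ A}))]
  · refine Finset.sum_congr rfl fun j hj => ?_
    have h := (Nat.lt_sInf_iff (s := {j | g j ∉ A}) hg).1 (Finset.mem_range.1 hj)
    simp only [Set.mem_ofPred_eq, not_not] at h
    rw [Finset.prod_eq_one, one_mul, Set.indicator_of_mem (h j le_rfl)]
    intro i hi
    rw [Set.indicator_of_mem (h i (Finset.mem_range.1 hi).le), Pi.one_apply]
  · intro j hj
    have hmem := Nat.sInf_mem (s := {j | g j ∉ A}) hg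
    simp only [Finset.mem_range, not_lt] at hj
    rcases hj.eq_or_lt with e | hlt
    · rw [← e, Set.indicator_of_notMem hmem, mul_zero]
    · rw [Finset.prod_eq_zero (Finset.mem_range.2 hlt), zero_mul]
      exact Set.indicator_of_notMem hmem _

section Sequence

variable {X : Type*} [MeasurableSpace X] (ν : Measure X) [IsProbabilityMeasure ν]

theorem measurable_seqCons : Measurable (seqCons (X := X)) := by
  refine measurable_pi_iff.2 fun n => ?_
  cases n with
  | zero => exact measurable_fst
  | succ n => exact (measurable_pi_apply n).comp measurable_snd

/-- The tail of an i.i.d. sequence is independent of its head and has the law of the whole sequence;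
this is the renewal property behind every recursion below. -/
theorem map_seqCons_prod_infinitePi :
    (ν.prod (Measure.infinitePi fun _ : ℕ => ν)).map seqCons =
      Measure.infinitePi fun _ : ℕ => ν := by
  classical
  refine Measure.eq_infinitePi _ fun s t ht => ?_
  obtain ⟨N, hN⟩ : ∃ N, s ⊆ Finset.range (N + 1) :=
    ⟨s.sup id, fun i hi => Finset.mem_range.2 (Nat.lt_succ_of_le (Finset.le_sup (f := id) hi))⟩
  -- Padding with `univ` turns the finite index set into an initial segment, whose box splits as the
  -- head times a box for the shifted tail.
  set t' : ℕ → Set X := fun i => if i ∈ s then t i else Set.univ with ht'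
  have ht'm : ∀ i, MeasurableSet (t' i) := fun i => by
    simp only [ht']; split_ifs
    exacts [ht i, MeasurableSet.univ]
  have h1 : ∏ i ∈ s, ν (t i) = ∏ i ∈ Finset.range (N + 1), ν (t' i) := by
    rw [← Finset.prod_subset hN]
    · exact Finset.prod_congr rfl fun i hi => by simp [ht', hi]
    · intro i _ hi; simp [ht', hi]
  have h2 : seqCons ⁻¹' ((s : Set ℕ).pi t) =
      t' 0 ×ˢ ((Finset.range N : Set ℕ).pi fun i => t' (i + 1)) := by
    ext p
    simp only [Set.mem_preimage, Set.mem_pi, Finset.mem_coe, Set.mem_prod, Finset.mem_range]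
    constructor
    · intro h
      refine ⟨?_, fun i _ => ?_⟩
      · simp only [ht']; split_ifs with h0
        exacts [h 0 h0, trivial]
      · simp only [ht']; split_ifs with h0
        exacts [h _ h0, trivial]
    · rintro ⟨h0, hi⟩ i his
      cases i with
      | zero => simpa [ht', his] using h0
      | succ i =>
        have := hi i (by simpa using Finset.mem_range.1 (hN his))
        simpa [ht', his] using this
  rw [Measure.map_apply measurable_seqCons (MeasurableSet.pi s.countable_toSet fun i _ => ht i), h2,
    Measure.prod_prod, Measure.infinitePi_pi _ fun i _ => ht'm _, h1, Finset.prod_range_succ',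
    mul_comm]

theorem lintegral_infinitePi_seqCons {F : (ℕ → X) → ℝ≥0∞} (hF : Measurable F) :
    ∫⁻ g, F g ∂(Measure.infinitePi fun _ : ℕ => ν) =
      ∫⁻ x, ∫⁻ g, F (seqCons (x, g)) ∂(Measure.infinitePi fun _ : ℕ => ν) ∂ν := by
  conv_lhs => rw [← map_seqCons_prod_infinitePi ν]
  rw [lintegral_map hF measurable_seqCons,
    lintegral_prod (fun p => F (seqCons p)) (hF.comp measurable_seqCons).aemeasurable]

theorem lintegral_prod_range_mul_infinitePi {a b : X → ℝ≥0∞} (ha : Measurable a)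
    (hb : Measurable b) (j : ℕ) :
    ∫⁻ g, (∏ i ∈ Finset.range j, a (g i)) * b (g j) ∂(Measure.infinitePi fun _ : ℕ => ν) =
      (∫⁻ x, a x ∂ν) ^ j * ∫⁻ x, b x ∂ν := by
  have hm : ∀ j : ℕ, Measurable fun g : ℕ → X => (∏ i ∈ Finset.range j, a (g i)) * b (g j) :=
    fun j => (Finset.measurable_prod _ fun i _ => ha.comp (measurable_pi_apply i)).mul
      (hb.comp (measurable_pi_apply j))
  induction j with
  | zero =>
    rw [lintegral_infinitePi_seqCons ν (hm 0)]
    simp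
  | succ j ih =>
    rw [lintegral_infinitePi_seqCons ν (hm _)]
    simp only [Finset.prod_range_succ', seqCons_succ, seqCons_zero]
    have : ∀ x, ∫⁻ g : ℕ → X, (∏ i ∈ Finset.range j, a (g i)) * a x * b (g j)
        ∂(Measure.infinitePi fun _ : ℕ => ν) = a x * ((∫⁻ x, a x ∂ν) ^ j * ∫⁻ x, b x ∂ν) := by
      intro x
      rw [← ih, ← lintegral_const_mul _ (hm j)]
      exact lintegral_congr fun g => by ring
    simp_rw [this]
    rw [lintegral_mul_const _ ha]
    ring

/-- In an i.i.d. sequence, an event of probability less than one fails sooner or later. -/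
theorem ae_infinitePi_exists_notMem {A : Set X} (hA : MeasurableSet A) (h1 : ν Aᶜ ≠ 0) :
    ∀ᵐ g ∂(Measure.infinitePi fun _ : ℕ => ν), ∃ j, g j ∉ A := by
  have hlt : ν A < 1 := by
    rw [prob_compl_eq_one_sub hA] at h1
    exact lt_of_le_of_ne prob_le_one fun h => h1 (by simp [h])
  rw [ae_iff]
  refine le_antisymm ?_ zero_le
  -- Staying in `A` forever is contained in staying there for `n` steps, of probability `ν A ^ n`.
  refine ge_of_tendsto' (ENNReal.tendsto_pow_atTop_nhds_zero_of_lt_one hlt) fun n => ?_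
  calc (Measure.infinitePi fun _ : ℕ => ν) {g | ¬ ∃ j, g j ∉ A}
      ≤ (Measure.infinitePi fun _ : ℕ => ν) ((Finset.range n : Set ℕ).pi fun _ => A) :=
        measure_mono fun g hg i _ => by simpa using not_exists.1 hg i
    _ = ν A ^ n := by
      rw [Measure.infinitePi_pi _ fun _ _ => hA]; simp

/-- The mean of a sum of terms of an i.i.d. sequence, up to the first term outside of `A`. -/
theorem lintegral_sum_range_sInf {A : Set X} (hA : MeasurableSet A) (h1 : ν Aᶜ ≠ 0)
    {f : X → ℝ≥0∞} (hf : Measurable f) :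
    ∫⁻ g, ∑ j ∈ Finset.range (sInf {j | g j ∉ A}), f (g j)
      ∂(Measure.infinitePi fun _ : ℕ => ν) = (∫⁻ x in A, f x ∂ν) / ν Aᶜ := by
  rw [lintegral_congr_ae ((ae_infinitePi_exists_notMem ν hA h1).mono
    fun g hg => sum_range_sInf_eq_tsum f hg)]
  have ha : Measurable (A.indicator (1 : X → ℝ≥0∞)) := measurable_one.indicator hA
  have hb : Measurable (A.indicator f) := hf.indicator hA
  have hm : ∀ j : ℕ, Measurable fun g : ℕ → X =>
      (∏ i ∈ Finset.range j, A.indicator (1 : X → ℝ≥0∞) (g i)) * A.indicator f (g j) := fun j =>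
    (Finset.measurable_prod _ fun i _ => ha.comp (measurable_pi_apply i)).mul
      (hb.comp (measurable_pi_apply j))
  rw [lintegral_tsum fun j => (hm j).aemeasurable]
  simp_rw [lintegral_prod_range_mul_infinitePi ν ha hb]
  -- The ratio of the geometric series is `ν A`, and `1 - ν A = ν Aᶜ`.
  rw [ENNReal.tsum_mul_right, ENNReal.tsum_geometric, lintegral_indicator_one hA,
    lintegral_indicator hA, prob_compl_eq_one_sub hA, mul_comm, ENNReal.div_eq_inv_mul, mul_comm]

end Sequence

/-! ### The exponential law. -/

section Exponential

variable {l : ℝ}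

theorem lintegral_expMeasure (f : ℝ → ℝ≥0∞) (hf : Measurable f) :
    ∫⁻ x, f x ∂(expMeasure l) =
      ∫⁻ x in Set.Ioi 0, ENNReal.ofReal (l * Real.exp (-l * x)) * f x := by
  have h : expMeasure l = volume.withDensity (exponentialPDF l) := rfl
  have hm : Measurable (exponentialPDF l) := (measurable_exponentialPDFReal l).ennreal_ofReal
  rw [h, lintegral_withDensity_eq_lintegral_mul _ hm hf, ← setLIntegral_univ,
    ← Set.Iio_union_Ici (a := (0 : ℝ)), lintegral_union measurableSet_Ici (by simp),
    setLIntegral_congr Ioi_ae_eq_Ici]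
  have h0 : ∫⁻ x in Set.Iio 0, (exponentialPDF l * f) x = 0 := by
    rw [setLIntegral_congr_fun (g := fun _ => 0) measurableSet_Iio]
    · simp
    · intro x hx; simp [exponentialPDF_of_neg (show x < 0 from hx)]
  rw [h0, zero_add]
  refine setLIntegral_congr_fun measurableSet_Ici fun x hx => ?_
  simp [exponentialPDF_of_nonneg (show 0 ≤ x from hx)]

theorem expMeasure_absolutelyContinuous : expMeasure l ≪ volume :=
  withDensity_absolutelyContinuous _ _

theorem noAtoms_expMeasure (x : ℝ) : expMeasure l {x} = 0 :=
  expMeasure_absolutelyContinuous (by simp)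

theorem expMeasure_Ioi (hl : 0 < l) {y : ℝ} (hy : 0 ≤ y) :
    expMeasure l (Set.Ioi y) = ENNReal.ofReal (Real.exp (-l * y)) := by
  have := isProbabilityMeasure_expMeasure hl
  rw [← Set.compl_Iic, prob_compl_eq_one_sub measurableSet_Iic, ← ofReal_cdf,
    cdf_expMeasure_eq hl, if_pos hy, ← ENNReal.ofReal_one, ← ENNReal.ofReal_sub]
  · congr 1; ring_nf
  · simp; positivity

theorem expMeasure_Iio (hl : 0 < l) {y : ℝ} (hy : 0 ≤ y) :
    expMeasure l (Set.Iio y) = ENNReal.ofReal (1 - Real.exp (-l * y)) := by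
  have := isProbabilityMeasure_expMeasure hl
  have h : expMeasure l (Set.Iio y) = expMeasure l (Set.Iic y) := by
    refine measure_congr ?_
    refine (ae_iff.2 ?_ : ∀ᵐ x ∂expMeasure l, x ≠ y).mono fun x hx => ?_
    · simpa using noAtoms_expMeasure y
    · exact propext ⟨fun h => le_of_lt h, fun h => lt_of_le_of_ne h hx⟩
  rw [h, ← ofReal_cdf, cdf_expMeasure_eq hl, if_pos hy]
  ring_nf

theorem ae_expMeasure_pos (hl : 0 < l) : ∀ᵐ x ∂(expMeasure l), 0 < x := by
  have := isProbabilityMeasure_expMeasure hl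
  have h := expMeasure_Ioi hl le_rfl
  rw [mul_zero, Real.exp_zero, ENNReal.ofReal_one] at h
  exact (prob_compl_eq_zero_iff measurableSet_Ioi).2 h

theorem lintegral_id_expMeasure (hl : 0 < l) :
    ∫⁻ x, ENNReal.ofReal x ∂(expMeasure l) = ENNReal.ofReal (1 / l) := by
  rw [lintegral_expMeasure _ ENNReal.measurable_ofReal]
  have h := Real.integral_rpow_mul_exp_neg_mul_Ioi (a := 2) (r := l) (by norm_num) hl
  have e : ∀ t : ℝ, t ^ ((2 : ℝ) - 1) * Real.exp (-(l * t)) = t * Real.exp (-(l * t)) := by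
    intro t; norm_num
  simp_rw [e] at h
  -- A function that is not integrable has Bochner integral `0`, so the positive value `h` gives
  -- integrability.
  have hi : IntegrableOn (fun t : ℝ => t * Real.exp (-(l * t))) (Set.Ioi 0) :=
    .of_integral_ne_zero (by
      rw [h]
      have := Real.Gamma_pos_of_pos (s := 2) (by norm_num)
      positivity)
  have hG : Real.Gamma 2 = 1 := by
    simp
  rw [setLIntegral_congr_fun (g := fun t => ENNReal.ofReal (l * (t * Real.exp (-(l * t)))))
    measurableSet_Ioi, ← ofReal_integral_eq_lintegral_ofReal (hi.const_mul l)]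
  · rw [integral_const_mul, h]
    congr 1
    rw [hG]
    norm_num
    field_simp
  · refine (ae_restrict_iff' measurableSet_Ioi).2 (ae_of_all _ fun x hx => ?_)
    have : 0 < x := hx
    simp only [Pi.zero_apply]; positivity
  · intro x hx
    have hx : 0 < x := hx
    simp only
    rw [← ENNReal.ofReal_mul (by positivity)]
    ring_nf

end Exponential

/-! ### The geometric law of the cluster size. -/

namespace HighwayIPS.Highway

variable {h : Highway}

/-- The probability `e^{-λ r}` that a car spacing ends the cluster. -/
theorem exp_mem_Ioo (hlam : 0 < h.lam) (hr : 0 < h.r) :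
    Real.exp (-h.lam * h.r) ∈ Set.Ioo (0 : ℝ) 1 :=
  ⟨Real.exp_pos _, Real.exp_lt_one_iff.2 (by nlinarith [mul_pos hlam hr])⟩

theorem PN_pos (hlam : 0 < h.lam) (hr : 0 < h.r) (k : ℕ) : 0 < h.PN k := by
  have := exp_mem_Ioo hlam hr
  exact mul_pos this.1 (pow_pos (by linarith [this.2]) _)

theorem measurable_clusterSize (r : ℝ) : Measurable (clusterSize r) :=
  (measurable_sInf_setOf fun j =>
    measurableSet_lt measurable_const (measurable_pi_apply j)).add_const 1

theorem isProbabilityMeasure_sizeLaw (hlam : 0 < h.lam) : IsProbabilityMeasure h.sizeLaw := by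
  have := isProbabilityMeasure_expMeasure hlam
  exact Measure.isProbabilityMeasure_map (measurable_clusterSize _).aemeasurable

theorem sizeLaw_zero : h.sizeLaw {0} = 0 := by
  rw [sizeLaw, Measure.map_apply (measurable_clusterSize _) (by measurability)]
  convert measure_empty (μ := Measure.infinitePi fun _ : ℕ => expMeasure h.lam)
  ext s
  simp [clusterSize]

/-- Gain functions are constrained only at `n ≥ 1`; this null set removes the arbitrary value `F 0`.
-/
theorem ae_sizeLaw_pos : ∀ᵐ n ∂h.sizeLaw, 1 ≤ n := by
  rw [ae_iff]
  convert sizeLaw_zero (h := h)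
  ext n
  simp

theorem sizeLaw_succ (hlam : 0 < h.lam) (hr : 0 < h.r) (k : ℕ) :
    h.sizeLaw {k + 1} = ENNReal.ofReal (h.PN (k + 1)) := by
  have := isProbabilityMeasure_expMeasure hlam
  have hp := exp_mem_Ioo hlam hr
  have hc : expMeasure h.lam (Set.Iic h.r)ᶜ = ENNReal.ofReal (Real.exp (-h.lam * h.r)) := by
    rw [Set.compl_Iic, expMeasure_Ioi hlam hr.le]
  have hA : expMeasure h.lam (Set.Iic h.r) = ENNReal.ofReal (1 - Real.exp (-h.lam * h.r)) := by
    have := prob_compl_eq_one_sub (μ := expMeasure h.lam) (measurableSet_Iic (a := h.r)).compl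
    rw [compl_compl] at this
    rw [this, hc, ← ENNReal.ofReal_one, ← ENNReal.ofReal_sub _ hp.1.le]
  -- The equality holds only almost everywhere: a sequence with no spacing above `r` is assigned
  -- size `1` by `sInf ∅ = 0`.
  have hae : clusterSize h.r ⁻¹' {k + 1} =ᵐ[Measure.infinitePi fun _ : ℕ => expMeasure h.lam]
      ((Finset.range (k + 1) : Set ℕ).pi
        fun i => if i < k then Set.Iic h.r else (Set.Iic h.r)ᶜ) := by
    filter_upwards [ae_infinitePi_exists_notMem (expMeasure h.lam)
      (measurableSet_Iic (a := h.r)) (by rw [hc]; simpa using hp.1)] with s hs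
    refine propext ?_
    change clusterSize h.r s = k + 1 ↔ ∀ i ∈ (Finset.range (k + 1) : Set ℕ),
      s i ∈ (if i < k then Set.Iic h.r else (Set.Iic h.r)ᶜ)
    have hs' : {k | h.r < s k}.Nonempty := by
      obtain ⟨j, hj⟩ := hs
      exact ⟨j, by simpa using hj⟩
    rw [clusterSize, Nat.add_right_cancel_iff]
    constructor
    · intro e i hi
      split_ifs with hik
      · have := Nat.notMem_of_lt_sInf (e ▸ hik : i < sInf {k | h.r < s k})
        simpa using this
      · have : i = k := by
          have := Finset.mem_range.1 (Finset.mem_coe.1 hi); omega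
        subst this
        have := Nat.sInf_mem hs'
        rw [e] at this
        simpa using this
    · intro hi
      refine le_antisymm (Nat.sInf_le ?_) ?_
      · simpa using hi k (by simp)
      · by_contra hlt
        rw [not_le] at hlt
        have h1 := hi (sInf {k | h.r < s k}) (by simpa using hlt.le)
        rw [if_pos hlt] at h1
        have h2 := Nat.sInf_mem hs'
        exact absurd h2 (by simpa using h1)
  rw [sizeLaw, Measure.map_apply (measurable_clusterSize _) (by measurability),
    measure_congr hae, Measure.infinitePi_pi]
  · rw [Finset.prod_range_succ, if_neg (lt_irrefl k), hc,
      Finset.prod_congr rfl (g := fun _ => expMeasure h.lam (Set.Iic h.r))]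
    · rw [Finset.prod_const, Finset.card_range, hA, ← ENNReal.ofReal_pow (by linarith [hp.2]),
        ← ENNReal.ofReal_mul (pow_nonneg (by linarith [hp.2]) _), PN, Nat.add_sub_cancel, mul_comm]
    · intro i hi; rw [if_pos (Finset.mem_range.1 hi)]
  · intro i _
    split_ifs
    exacts [measurableSet_Iic, measurableSet_Iic.compl]

theorem lintegral_sizeLaw (hlam : 0 < h.lam) (hr : 0 < h.r) (f : ℕ → ℝ≥0∞) :
    ∫⁻ n, f n ∂h.sizeLaw = ∑' k : ℕ, ENNReal.ofReal (h.PN (k + 1)) * f (k + 1) := by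
  rw [lintegral_countable', tsum_eq_zero_add' ENNReal.summable, sizeLaw_zero, mul_zero, zero_add]
  simp_rw [sizeLaw_succ hlam hr, mul_comm]

theorem tsum_ofReal_PN (hlam : 0 < h.lam) (hr : 0 < h.r) :
    ∑' k : ℕ, ENNReal.ofReal (h.PN (k + 1)) = 1 := by
  have := isProbabilityMeasure_sizeLaw hlam
  simpa using (lintegral_sizeLaw hlam hr fun _ => 1).symm

theorem summable_PN (hlam : 0 < h.lam) (hr : 0 < h.r) :
    Summable fun k : ℕ => h.PN (k + 1) := by
  have := ENNReal.summable_toReal (f := fun k : ℕ => ENNReal.ofReal (h.PN (k + 1)))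
    (by rw [tsum_ofReal_PN hlam hr]; simp)
  simpa [ENNReal.toReal_ofReal (PN_pos hlam hr _).le] using this

/-- A bounded function averaged over the cluster size. -/
theorem lintegral_sizeLaw_ofReal (hlam : 0 < h.lam) (hr : 0 < h.r) {f : ℕ → ℝ}
    (hf0 : ∀ k, 1 ≤ k → 0 ≤ f k) (hf1 : ∀ k, 1 ≤ k → f k ≤ 1) :
    (Summable fun k : ℕ => h.PN (k + 1) * f (k + 1)) ∧
    ∫⁻ n, ENNReal.ofReal (f n) ∂h.sizeLaw =
      ENNReal.ofReal (∑' k : ℕ, h.PN (k + 1) * f (k + 1)) := by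
  have hn : ∀ k : ℕ, 0 ≤ h.PN (k + 1) * f (k + 1) := fun k =>
    mul_nonneg (PN_pos hlam hr _).le (hf0 _ (by omega))
  have hs : Summable fun k : ℕ => h.PN (k + 1) * f (k + 1) :=
    Summable.of_nonneg_of_le hn
      (fun k => mul_le_of_le_one_right (PN_pos hlam hr _).le (hf1 _ (by omega)))
      (summable_PN hlam hr)
  refine ⟨hs, ?_⟩
  rw [lintegral_sizeLaw hlam hr, ENNReal.ofReal_tsum_of_nonneg hn hs]
  exact tsum_congr fun k => (ENNReal.ofReal_mul (PN_pos hlam hr _).le).symm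

end HighwayIPS.Highway

/-! ### The normal quantile and the range gain. -/

section Quantile

theorem cdf_gaussianReal_lt_one (x : ℝ) : cdf (gaussianReal 0 1) x < 1 := by
  rw [cdf_eq_real]
  refine lt_of_le_of_ne measureReal_le_one fun e => ?_
  have h0 : gaussianReal 0 1 (Set.Ioi x) = 0 := by
    rw [← Set.compl_Iic, prob_compl_eq_zero_iff measurableSet_Iic]
    rw [measureReal_def] at e
    rw [← ENNReal.ofReal_toReal (measure_ne_top (gaussianReal 0 1) _), e, ENNReal.ofReal_one]
  have := gaussianReal_absolutelyContinuous' 0 (v := 1) one_ne_zero h0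
  simp at this

theorem bddBelow_quantile {p : ℝ} (hp : 0 < p) :
    BddBelow {x : ℝ | p ≤ cdf (gaussianReal 0 1) x} := by
  obtain ⟨a, ha⟩ := ((tendsto_cdf_atBot (gaussianReal 0 1)).eventually (gt_mem_nhds hp)).exists
  refine ⟨a, fun x hx => ?_⟩
  by_contra hlt
  exact absurd (hx.trans (monotone_cdf _ (not_le.1 hlt).le)) (not_le.2 ha)

theorem nonempty_quantile {p : ℝ} (hp : p < 1) :
    {x : ℝ | p ≤ cdf (gaussianReal 0 1) x}.Nonempty := by
  obtain ⟨a, ha⟩ := ((tendsto_cdf_atTop (gaussianReal 0 1)).eventually (lt_mem_nhds hp)).exists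
  exact ⟨a, ha.le⟩

theorem normalQuantile_mono {p q : ℝ} (hp : 0 < p) (hpq : p ≤ q) (hq : q < 1) :
    normalQuantile p ≤ normalQuantile q :=
  csInf_le_csInf (bddBelow_quantile hp) (nonempty_quantile hq) fun _ hx => hpq.trans hx

theorem le_normalQuantile {p x : ℝ} (hp : cdf (gaussianReal 0 1) x < p) (hp1 : p < 1) :
    x ≤ normalQuantile p := by
  refine le_csInf (nonempty_quantile hp1) fun y hy => ?_
  by_contra hlt
  exact absurd (hp.trans_le (hy.trans (monotone_cdf _ (not_le.1 hlt).le))) (lt_irrefl _)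

/-- The distribution function stays below `1` at every `x`, so every `p` strictly between its value
at `x` and `1` has a quantile at least `x`. -/
theorem tendsto_normalQuantile : Tendsto normalQuantile (𝓝[<] 1) atTop := by
  refine tendsto_atTop.2 fun x => ?_
  filter_upwards [Ioo_mem_nhdsLT (cdf_gaussianReal_lt_one x)] with p hp
  exact le_normalQuantile hp.1 hp.2

end Quantile

namespace HighwayIPS.Highway

theorem isGainFunction_rangeGain {h : Highway} (hK : 0 < h.K) (hdel : 0 < h.del)
    (hPout0 : 0 < h.Pout) (hPout1 : h.Pout < 1)
    (hrange : 0 < Real.sqrt h.V1 * normalQuantile h.Pout + h.M1) :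
    IsGainFunction h.rangeGain := by
  have hs : 0 < h.sigma := Real.sqrt_pos.2 (by positivity)
  have hV2 : 0 < h.V2 := by unfold V2; positivity
  have hV12 : h.V1 = 2 * h.V2 := by unfold V1 V2; ring
  have hM1 : h.M1 = 1 - h.V1 := rfl
  have hM2 : h.M2 = 1 - h.V2 := rfl
  -- Because `(2σ² + 1)² = 4σ²(σ² + 1) + 1`, in fact `V1 < 1/9`.
  have hV1 : h.V1 < 1 := by
    unfold V1
    rw [div_lt_one (by positivity)]
    nlinarith [sq_nonneg h.sigma, sq_nonneg (h.sigma ^ 2)]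
  have hsq : 0 < Real.sqrt h.V2 := Real.sqrt_pos.2 hV2
  have hle : Real.sqrt h.V2 ≤ Real.sqrt h.V1 := Real.sqrt_le_sqrt (by linarith)
  have hpow : ∀ n : ℕ, 1 ≤ n → 0 < h.Pout ^ (1 / (n : ℝ)) ∧ h.Pout ^ (1 / (n : ℝ)) < 1 := by
    intro n hn
    have : (0 : ℝ) < n := by exact_mod_cast hn
    exact ⟨Real.rpow_pos_of_pos hPout0 _, Real.rpow_lt_one hPout0.le hPout1 (by positivity)⟩
  have hmono : ∀ m n : ℕ, 1 ≤ m → m ≤ n →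
      normalQuantile (h.Pout ^ (1 / (m : ℝ))) ≤ normalQuantile (h.Pout ^ (1 / (n : ℝ))) := by
    intro m n hm hmn
    refine normalQuantile_mono (hpow m hm).1 ?_ (hpow n (hm.trans hmn)).2
    have : (0 : ℝ) < m := by exact_mod_cast hm
    exact Real.rpow_le_rpow_of_exponent_ge hPout0 hPout1.le
      (one_div_le_one_div_of_le this (by exact_mod_cast hmn))
  have hbase : ∀ n : ℕ, 1 ≤ n →
      0 < Real.sqrt h.V2 * normalQuantile (h.Pout ^ (1 / (n : ℝ))) + h.M2 := by
    intro n hn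
    have h1 := hmono 1 n le_rfl hn
    simp only [Nat.cast_one, div_one, Real.rpow_one] at h1
    have h2 : Real.sqrt h.V2 * normalQuantile h.Pout ≤
      Real.sqrt h.V2 * normalQuantile (h.Pout ^ (1 / (n : ℝ))) := by gcongr
    -- For a nonnegative quantile `M2 > 0` suffices. For a negative one, `√V2 ≤ √V1` and `M2 ≥ M1`
    -- bound the base below by the quantity assumed positive.
    rcases le_or_gt 0 (normalQuantile h.Pout) with hq | hq
    · have := mul_nonneg hsq.le hq
      linarith
    · have := mul_le_mul_of_nonpos_right hle hq.le
      linarith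
  refine ⟨fun n hn => ?_, fun m n hm hmn => ?_, ?_⟩
  · have := hbase n hn
    unfold rangeGain
    positivity
  · have h1 := hbase m hm
    have h2 := hmono m n hm hmn
    unfold rangeGain
    gcongr
  · have hdc : 0 < (Real.sqrt h.V1 * normalQuantile h.Pout + h.M1) ^ 3 := by positivity
    have ht : Tendsto (fun n : ℕ => h.Pout ^ (1 / (n : ℝ))) atTop (𝓝[<] 1) := by
      refine tendsto_nhdsWithin_iff.2 ⟨?_, ?_⟩
      · have := (tendsto_const_nhds (x := h.Pout)).rpow
          (tendsto_one_div_atTop_nhds_zero_nat (𝕜 := ℝ)) (Or.inl hPout0.ne')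
        simpa using this
      · filter_upwards [eventually_ge_atTop 1] with n hn
        exact (hpow n hn).2
    have h1 := (((tendsto_normalQuantile.comp ht).const_mul_atTop hsq).atTop_add
      (tendsto_const_nhds (x := h.M2)))
    have h2 := ((tendsto_pow_atTop (α := ℝ) (n := 3) (by norm_num)).comp h1).const_mul_atTop
      (zero_lt_two (α := ℝ))
    exact (tendsto_rpow_atTop (y := 1 / h.del) (by positivity)).comp (h2.atTop_div_const hdc)

end HighwayIPS.Highway

/-! ### The forwarding distance and its mean. -/

theorem ae_infinitePi_forall {X : Type*} [MeasurableSpace X] {ν : Measure X}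
    [IsProbabilityMeasure ν] {p : X → Prop} (hp : ∀ᵐ x ∂ν, p x) :
    ∀ᵐ g ∂(Measure.infinitePi fun _ : ℕ => ν), ∀ j, p (g j) :=
  ae_all_iff.2 fun j =>
    (measurePreserving_eval_infinitePi (fun _ : ℕ => ν) j).quasiMeasurePreserving.ae hp

theorem lintegral_uniformOfFintype_bool (f : Bool → ℝ≥0∞) :
    ∫⁻ b, f b ∂(PMF.uniformOfFintype Bool).toMeasure = f true / 2 + f false / 2 := by
  rw [lintegral_countable', tsum_bool]
  simp [ENNReal.div_eq_inv_mul, mul_comm, add_comm]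

/-- Integrability and mean of a nonnegative random variable, from its law. -/
theorem integrable_and_integral_of_hasLaw {Ω : Type*} [MeasurableSpace Ω] {μ : Measure Ω}
    {X : Ω → ℝ} {L : Measure ℝ} (hX : HasLaw X L μ) (h0 : ∀ᵐ x ∂L, 0 ≤ x) {m : ℝ} (hm : 0 ≤ m)
    (hL : ∫⁻ x, ENNReal.ofReal x ∂L = ENNReal.ofReal m) :
    Integrable X μ ∧ ∫ ω, X ω ∂μ = m := by
  have h0' : ∀ᵐ ω ∂μ, 0 ≤ X ω := ae_of_ae_map hX.aemeasurable (by rwa [hX.map_eq])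
  have hl : ∫⁻ ω, ENNReal.ofReal (X ω) ∂μ = ENNReal.ofReal m := by
    rw [← hL, ← hX.map_eq, lintegral_map' ENNReal.measurable_ofReal.aemeasurable hX.aemeasurable]
  refine ⟨⟨hX.aemeasurable.aestronglyMeasurable, ?_⟩, ?_⟩
  · rw [hasFiniteIntegral_iff_ofReal h0', hl]
    exact ENNReal.ofReal_lt_top
  · rw [integral_eq_lintegral_of_nonneg_ae h0' hX.aemeasurable.aestronglyMeasurable, hl,
      ENNReal.toReal_ofReal hm]

namespace HighwayIPS.Highway

variable {h : Highway} {F : ℕ → ℝ}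

/-- The set of the bridged gaps. -/
def bridgedSet (r : ℝ) (F : ℕ → ℝ) : Set (ℝ × ℕ × ℕ × Bool) :=
  {q | (GapData.ofProd q).Bridged r F}

theorem bridgedSet_eq (r : ℝ) (F : ℕ → ℝ) :
    bridgedSet r F = {q | q.1 <
      if q.2.2.2 then r * (F q.2.2.1 + F q.2.1) else r * F q.2.1} := by
  ext ⟨x, n, m, b⟩
  cases b <;> simp [bridgedSet, GapData.Bridged, GapData.ofProd]

theorem measurableSet_bridgedSet (r : ℝ) (F : ℕ → ℝ) : MeasurableSet (bridgedSet r F) := by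
  rw [bridgedSet_eq]
  refine measurableSet_lt measurable_fst ?_
  exact (Measurable.of_discrete (f := fun y : ℕ × ℕ × Bool =>
    if y.2.2 then r * (F y.2.1 + F y.1) else r * F y.1)).comp measurable_snd

theorem isProbabilityMeasure_gapLaw (hlam : 0 < h.lam) : IsProbabilityMeasure h.gapLaw := by
  have := isProbabilityMeasure_expMeasure hlam
  have := isProbabilityMeasure_sizeLaw hlam
  unfold gapLaw
  infer_instance

/-- Integrating out the length first leaves only discrete variables, for which measurability is
automatic. -/
theorem gapLaw_apply (hlam : 0 < h.lam) {A : Set (ℝ × ℕ × ℕ × Bool)} (hA : MeasurableSet A) :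
    h.gapLaw A = ∫⁻ n, ∫⁻ m, (expMeasure h.lam {x | (x, n, m, true) ∈ A} / 2 +
      expMeasure h.lam {x | (x, n, m, false) ∈ A} / 2) ∂h.sizeLaw ∂h.sizeLaw := by
  have := isProbabilityMeasure_expMeasure hlam
  have := isProbabilityMeasure_sizeLaw hlam
  have hm {f : ℕ × ℕ × Bool → ℝ≥0∞} : Measurable f := Measurable.of_discrete
  have hm' {f : ℕ × Bool → ℝ≥0∞} : Measurable f := Measurable.of_discrete
  rw [gapLaw, Measure.prod_apply_symm hA, lintegral_prod _ hm.aemeasurable]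
  refine lintegral_congr fun n => ?_
  rw [lintegral_prod _ hm'.aemeasurable]
  refine lintegral_congr fun m => ?_
  rw [lintegral_uniformOfFintype_bool]
  rfl

theorem exp_range_mem_Icc (hlam : 0 < h.lam) {y : ℝ} (hy : 0 ≤ y) :
    0 ≤ 1 - Real.exp (-h.lam * y) ∧ 1 - Real.exp (-h.lam * y) ≤ 1 := by
  have h1 : Real.exp (-h.lam * y) ≤ 1 := Real.exp_le_one_iff.2 (by nlinarith)
  have := Real.exp_pos (-h.lam * y)
  constructor <;> linarith

theorem gapLaw_bridgedSet (hlam : 0 < h.lam) (hr : 0 < h.r) (hF : IsGainFunction F) :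
    h.gapLaw (bridgedSet h.r F) = ENNReal.ofReal (h.Pb F) ∧ 0 ≤ h.Pb F := by
  have hprob := isProbabilityMeasure_sizeLaw hlam
  set E1 : ℕ → ℝ := fun n => 1 - Real.exp (-h.lam * (h.r * F n)) with hE1
  set E2 : ℕ → ℕ → ℝ := fun n m => 1 - Real.exp (-h.lam * (h.r * (F m + F n))) with hE2
  have hE1' : ∀ n, 1 ≤ n → 0 ≤ E1 n ∧ E1 n ≤ 1 := fun n hn =>
    exp_range_mem_Icc hlam (mul_nonneg hr.le (hF.pos n hn).le)
  have hE2' : ∀ n m, 1 ≤ n → 1 ≤ m → 0 ≤ E2 n m ∧ E2 n m ≤ 1 := fun n m hn hm =>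
    exp_range_mem_Icc hlam (mul_nonneg hr.le (add_pos (hF.pos m hm) (hF.pos n hn)).le)
  set S : ℕ → ℝ := fun n => ∑' m : ℕ, h.PN (m + 1) * E2 n (m + 1) with hS
  have hSl : ∀ n, 1 ≤ n → ∫⁻ m, ENNReal.ofReal (E2 n m) ∂h.sizeLaw = ENNReal.ofReal (S n) :=
    fun n hn => (lintegral_sizeLaw_ofReal hlam hr (fun m hm => (hE2' n m hn hm).1)
      fun m hm => (hE2' n m hn hm).2).2
  have hS0 : ∀ n, 1 ≤ n → 0 ≤ S n := fun n hn =>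
    tsum_nonneg fun m => mul_nonneg (PN_pos hlam hr _).le (hE2' n _ hn (by omega)).1
  -- The bound by `1` allows `lintegral_sizeLaw_ofReal` to be used again for the outer sum.
  have hS1 : ∀ n, 1 ≤ n → S n ≤ 1 := by
    intro n hn
    rw [← ENNReal.ofReal_le_one, ← hSl n hn]
    calc ∫⁻ m, ENNReal.ofReal (E2 n m) ∂h.sizeLaw ≤ ∫⁻ _, 1 ∂h.sizeLaw := by
          refine lintegral_mono_ae (ae_sizeLaw_pos.mono fun m hm => ?_)
          exact ENNReal.ofReal_le_one.2 (hE2' n m hn hm).2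
      _ = 1 := by simp
  have hl1 := lintegral_sizeLaw_ofReal hlam hr (fun n hn => (hE1' n hn).1) fun n hn => (hE1' n hn).2
  have hl2 := lintegral_sizeLaw_ofReal hlam hr hS0 hS1
  have hT1 : 0 ≤ ∑' k : ℕ, h.PN (k + 1) * E1 (k + 1) :=
    tsum_nonneg fun m => mul_nonneg (PN_pos hlam hr _).le (hE1' _ (by omega)).1
  have hT2 : 0 ≤ ∑' k : ℕ, h.PN (k + 1) * S (k + 1) :=
    tsum_nonneg fun m => mul_nonneg (PN_pos hlam hr _).le (hS0 _ (by omega))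
  have hPb : h.Pb F = (∑' k : ℕ, h.PN (k + 1) * S (k + 1)) / 2 +
      (∑' k : ℕ, h.PN (k + 1) * E1 (k + 1)) / 2 := by
    have e1 : ∀ n : ℕ, (1 - Real.exp (-h.lam * h.r * F (n + 1))) * h.PN (n + 1) =
        h.PN (n + 1) * E1 (n + 1) := fun n => by simp only [hE1]; ring_nf
    -- The range sum is symmetric in the two sizes, so the outer index of `Pb` may be taken as the
    -- eastbound size, which `gapLaw_apply` integrates last.
    have e2 : ∀ m : ℕ, ∑' n : ℕ, (1 - Real.exp (-h.lam * h.r * (F (m + 1) + F (n + 1)))) *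
        h.PN (m + 1) * h.PN (n + 1) = h.PN (m + 1) * S (m + 1) := fun m => by
      rw [hS, ← tsum_mul_left]
      refine tsum_congr fun n => ?_
      simp only [hE2]
      rw [add_comm (F (m + 1)), mul_assoc (-h.lam)]
      ring
    rw [Pb]
    simp_rw [e1, e2]
    ring
  refine ⟨?_, by rw [hPb]; positivity⟩
  rw [gapLaw_apply hlam (measurableSet_bridgedSet _ _), bridgedSet_eq, hPb,
    ENNReal.ofReal_add (by positivity) (by positivity), ENNReal.ofReal_div_of_pos two_pos,
    ENNReal.ofReal_div_of_pos two_pos, ENNReal.ofReal_ofNat, ← hl1.2, ← hl2.2]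
  simp only [ENNReal.div_eq_inv_mul]
  rw [← lintegral_const_mul _ Measurable.of_discrete,
    ← lintegral_const_mul _ Measurable.of_discrete, ← lintegral_add_left Measurable.of_discrete]
  refine lintegral_congr_ae (ae_sizeLaw_pos.mono fun n hn => ?_)
  simp only
  rw [lintegral_add_left Measurable.of_discrete, lintegral_const_mul _ Measurable.of_discrete,
    lintegral_const_mul _ Measurable.of_discrete, ← hSl n hn]
  congr 2
  · refine lintegral_congr_ae (ae_sizeLaw_pos.mono fun m hm => ?_)
    exact expMeasure_Iio hlam (mul_nonneg hr.le (add_pos (hF.pos m hm) (hF.pos n hn)).le)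
  · simp only [Set.mem_ofPred_eq, Bool.false_eq_true, if_false, lintegral_const, measure_univ,
      mul_one]
    exact expMeasure_Iio hlam (mul_nonneg hr.le (hF.pos n hn).le)

theorem gapLaw_compl_bridgedSet_ne_zero (hlam : 0 < h.lam) :
    h.gapLaw (bridgedSet h.r F)ᶜ ≠ 0 := by
  have := isProbabilityMeasure_expMeasure hlam
  have := isProbabilityMeasure_sizeLaw hlam
  intro h0
  rw [gapLaw, Measure.prod_apply_symm (measurableSet_bridgedSet _ _).compl,
    lintegral_eq_zero_iff Measurable.of_discrete] at h0
  obtain ⟨y, hy⟩ := h0.exists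
  -- No sign of `F` is assumed here, hence the maximum with `0` before the exponential tail formula.
  refine absurd (measure_mono_null (fun x (hx : x ∈ Set.Ioi
    (max 0 (if y.2.2 then h.r * (F y.2.1 + F y.1) else h.r * F y.1))) => ?_) hy) ?_
  · rw [bridgedSet_eq]
    exact not_lt.2 ((le_max_right _ _).trans (le_of_lt (Set.mem_Ioi.1 hx)))
  · rw [expMeasure_Ioi hlam (le_max_left _ _)]
    simpa using Real.exp_pos _

theorem gapLaw_compl_bridgedSet (hlam : 0 < h.lam) (hr : 0 < h.r) (hF : IsGainFunction F) :
    h.gapLaw (bridgedSet h.r F)ᶜ = ENNReal.ofReal (1 - h.Pb F) ∧ h.Pb F < 1 := by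
  have := isProbabilityMeasure_gapLaw hlam
  have hb := gapLaw_bridgedSet hlam hr hF
  have h1 : h.gapLaw (bridgedSet h.r F)ᶜ = ENNReal.ofReal (1 - h.Pb F) := by
    rw [prob_compl_eq_one_sub (measurableSet_bridgedSet _ _), hb.1, ← ENNReal.ofReal_one,
      ← ENNReal.ofReal_sub _ hb.2]
  refine ⟨h1, ?_⟩
  have := gapLaw_compl_bridgedSet_ne_zero (h := h) (F := F) hlam
  rw [h1] at this
  simpa using this

theorem meanDistance_pos (hlam : 0 < h.lam) (hr : 0 < h.r) (hF : IsGainFunction F) :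
    0 < h.meanDistance F := by
  have := (gapLaw_compl_bridgedSet hlam hr hF).2
  exact one_div_pos.2 (mul_pos hlam (by linarith))

theorem lintegral_fst_gapLaw (hlam : 0 < h.lam) :
    ∫⁻ q, ENNReal.ofReal q.1 ∂h.gapLaw = ENNReal.ofReal (1 / h.lam) := by
  have := isProbabilityMeasure_expMeasure hlam
  have := isProbabilityMeasure_sizeLaw hlam
  rw [gapLaw, lintegral_prod (fun q => ENNReal.ofReal q.1)
    (ENNReal.measurable_ofReal.comp measurable_fst).aemeasurable]
  simp [lintegral_id_expMeasure hlam]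

theorem ae_gapLaw_fst_nonneg (hlam : 0 < h.lam) : ∀ᵐ q ∂h.gapLaw, 0 ≤ q.1 := by
  have := isProbabilityMeasure_expMeasure hlam
  have := isProbabilityMeasure_sizeLaw hlam
  exact Measure.quasiMeasurePreserving_fst.ae ((ae_expMeasure_pos hlam).mono fun x hx => hx.le)

theorem measurable_forwardDistance (r : ℝ) (F : ℕ → ℝ) : Measurable (forwardDistance r F) := by
  refine measurable_sum_range (measurable_sInf_setOf fun j => ?_)
    fun j => measurable_fst.comp (measurable_pi_apply j)
  exact (MeasurableSet.const _).inter
    ((measurableSet_bridgedSet r F).compl.preimage (measurable_pi_apply j))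

/-- The clause `1 ≤ j` exempts the blocking gap, so the stopping index is one more than the exit
index of the tail. Without an exit both infima would be `0` and the shift would fail. -/
theorem forwardDistance_seqCons (r : ℝ) (F : ℕ → ℝ) (x : ℝ × ℕ × ℕ × Bool)
    {g : ℕ → ℝ × ℕ × ℕ × Bool} (hg : ∃ j, g j ∉ bridgedSet r F) :
    forwardDistance r F (seqCons (x, g)) =
      x.1 + ∑ j ∈ Finset.range (sInf {j | g j ∉ bridgedSet r F}), (g j).1 := by
  have : sInf {j : ℕ | 1 ≤ j ∧ ¬ (GapData.ofProd (seqCons (x, g) j)).Bridged r F} =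
      sInf {j | g j ∉ bridgedSet r F} + 1 := by
    have hmem := Nat.sInf_mem (s := {j | g j ∉ bridgedSet r F}) hg
    have hmem' : sInf {j | g j ∉ bridgedSet r F} + 1 ∈
        {j : ℕ | 1 ≤ j ∧ ¬ (GapData.ofProd (seqCons (x, g) j)).Bridged r F} :=
      ⟨Nat.le_add_left _ _, hmem⟩
    refine le_antisymm (Nat.sInf_le hmem') (le_csInf ⟨_, hmem'⟩ ?_)
    rintro (_ | j) ⟨h1, h2⟩
    · omega
    · exact Nat.succ_le_succ (Nat.sInf_le h2)
  rw [forwardDistance, this, Finset.sum_range_succ', add_comm]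
  rfl


/-- Let `ν` be the gap law. Separating the blocking gap, the mean of `D` on the event that gap `0`
is unbridged equals the integral of the length over `Aᶜ` plus `ν Aᶜ` times the stopped mean `(∫
length over A) / ν Aᶜ`. The factors cancel and the two integrals recombine into the unconditional
mean `1 / λ`; the dependence between length and bridging is never computed. Conditioning divides by
`1 - Pb`. -/
theorem lintegral_distanceLaw (hlam : 0 < h.lam) (hr : 0 < h.r) (hF : IsGainFunction F) :
    ∫⁻ x, ENNReal.ofReal x ∂h.distanceLaw F = ENNReal.ofReal (h.meanDistance F) := by
  have := isProbabilityMeasure_gapLaw hlam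
  set A := bridgedSet h.r F with hAdef
  have hA : MeasurableSet A := measurableSet_bridgedSet _ _
  have hne := gapLaw_compl_bridgedSet_ne_zero (h := h) (F := F) hlam
  obtain ⟨hc, hPb⟩ := gapLaw_compl_bridgedSet hlam hr hF
  set P := Measure.infinitePi fun _ : ℕ => h.gapLaw with hP
  have hset : MeasurableSet {g : ℕ → ℝ × ℕ × ℕ × Bool | g 0 ∉ A} :=
    hA.compl.preimage (measurable_pi_apply 0)
  have hPset : P {g | g 0 ∉ A} = h.gapLaw Aᶜ :=
    (measurePreserving_eval_infinitePi (fun _ : ℕ => h.gapLaw) 0).measure_preimage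
      hA.compl.nullMeasurableSet
  have hmD := (measurable_forwardDistance h.r F).ennreal_ofReal
  have hm1 : Measurable fun q : ℝ × ℕ × ℕ × Bool => ENNReal.ofReal q.1 :=
    ENNReal.measurable_ofReal.comp measurable_fst
  have key : ∫⁻ g in {g | g 0 ∉ A}, ENNReal.ofReal (forwardDistance h.r F g) ∂P =
      ENNReal.ofReal (1 / h.lam) := by
    rw [← lintegral_indicator hset, lintegral_infinitePi_seqCons _ (hmD.indicator hset)]
    have hin : ∀ᵐ x ∂h.gapLaw, ∫⁻ g, {g : ℕ → ℝ × ℕ × ℕ × Bool | g 0 ∉ A}.indicator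
        (fun g => ENNReal.ofReal (forwardDistance h.r F g)) (seqCons (x, g)) ∂P =
        Aᶜ.indicator (fun x => ENNReal.ofReal x.1 +
          (∫⁻ q in A, ENNReal.ofReal q.1 ∂h.gapLaw) / h.gapLaw Aᶜ) x := by
      filter_upwards [ae_gapLaw_fst_nonneg hlam] with x hx
      by_cases hxA : x ∈ A
      · rw [Set.indicator_of_notMem (by simpa using hxA)]
        simp [hxA]
      · rw [Set.indicator_of_mem (by simpa using hxA),
          ← lintegral_sum_range_sInf h.gapLaw hA hne hm1,
          show ENNReal.ofReal x.1 = ∫⁻ _, ENNReal.ofReal x.1 ∂P by simp,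
          ← lintegral_add_left measurable_const]
        refine lintegral_congr_ae ?_
        filter_upwards [ae_infinitePi_exists_notMem h.gapLaw hA hne,
          ae_infinitePi_forall (ae_gapLaw_fst_nonneg hlam)] with g hg hg0
        rw [Set.indicator_of_mem (by simpa using hxA), forwardDistance_seqCons _ _ _ hg,
          ENNReal.ofReal_add hx (Finset.sum_nonneg fun j _ => hg0 j),
          ENNReal.ofReal_sum_of_nonneg fun j _ => hg0 j]
    rw [lintegral_congr_ae hin, lintegral_indicator hA.compl, lintegral_add_left hm1,
      setLIntegral_const, ENNReal.div_mul_cancel hne (measure_ne_top _ _), add_comm,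
      lintegral_add_compl _ hA, lintegral_fst_gapLaw hlam]
  rw [distanceLaw, lintegral_map ENNReal.measurable_ofReal (measurable_forwardDistance _ _),
    ProbabilityTheory.cond, lintegral_smul_measure]
  change (P {g | g 0 ∉ A})⁻¹ • ∫⁻ g in {g | g 0 ∉ A}, _ ∂P = _
  rw [key, hPset, hc, smul_eq_mul, ← ENNReal.ofReal_inv_of_pos (by linarith),
    ← ENNReal.ofReal_mul (by rw [inv_nonneg]; linarith), meanDistance]
  congr 1
  have : 1 - h.Pb F ≠ 0 := by linarith
  field_simp

theorem ae_distanceLaw_nonneg (hlam : 0 < h.lam) : ∀ᵐ x ∂h.distanceLaw F, 0 ≤ x := by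
  have := isProbabilityMeasure_gapLaw hlam
  rw [distanceLaw, ae_map_iff (measurable_forwardDistance _ _).aemeasurable measurableSet_Ici]
  refine cond_absolutelyContinuous.ae_le ?_
  filter_upwards [ae_infinitePi_forall (ae_gapLaw_fst_nonneg hlam)] with g hg
  exact Finset.sum_nonneg fun j _ => hg j

end HighwayIPS.Highway

/-! ### The waiting time and its mean. -/

/-- Unboundedness makes the supremum a maximum, and monotonicity makes the set an initial segment of
`n ≥ 1`. The case `n = 0` is excluded because `F 0` is arbitrary. -/
theorem le_floorInv_iff {F : ℕ → ℝ} (hF : IsGainFunction F) {n : ℕ} (hn : 1 ≤ n) (y : ℝ) :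
    n ≤ floorInv F y ↔ F n ≤ y := by
  have hb : BddAbove {n : ℕ | 1 ≤ n ∧ F n ≤ y} := by
    obtain ⟨N, hN⟩ := (tendsto_atTop.1 hF.unbounded (y + 1)).exists_forall_of_atTop
    refine ⟨N, fun m hm => ?_⟩
    by_contra hlt
    have := hN m (not_le.1 hlt).le
    linarith [hm.2]
  constructor
  · intro h
    have hne : {n : ℕ | 1 ≤ n ∧ F n ≤ y}.Nonempty := by
      by_contra he
      rw [Set.not_nonempty_iff_eq_empty] at he
      rw [floorInv, he, csSup_empty] at h
      simp at h
      omega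
    have hmem := Nat.sSup_mem hne hb
    exact (hF.mono _ _ hn h).trans hmem.2
  · intro h
    exact le_csSup hb ⟨hn, h⟩

namespace HighwayIPS.Highway

variable {h : Highway} {F : ℕ → ℝ}

theorem sizeLaw_Ioi (hlam : 0 < h.lam) (hr : 0 < h.r) (G : ℕ) :
    h.sizeLaw (Set.Ioi G) = ENNReal.ofReal ((1 - Real.exp (-h.lam * h.r)) ^ G) := by
  have := isProbabilityMeasure_sizeLaw hlam
  have hp := exp_mem_Ioo hlam hr
  induction G with
  | zero =>
    rw [pow_zero, ENNReal.ofReal_one]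
    refine (prob_compl_eq_zero_iff measurableSet_Ioi).1 ?_
    convert sizeLaw_zero (h := h)
    ext n; simp
  | succ G ih =>
    have hu : Set.Ioi G = Set.Ioi (G + 1) ∪ {G + 1} := by
      ext n
      simp only [Set.mem_Ioi, Set.mem_union, Set.mem_singleton_iff]
      omega
    have hd : Disjoint (Set.Ioi (G + 1)) {G + 1} := by simp
    rw [hu, measure_union hd (measurableSet_singleton _), sizeLaw_succ hlam hr] at ih
    have hP := PN_pos hlam hr (G + 1)
    refine (ENNReal.add_right_inj (a := ENNReal.ofReal (h.PN (G + 1))) ENNReal.ofReal_ne_top).1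
      ((add_comm _ _).trans (ih.trans ?_))
    rw [← ENNReal.ofReal_add hP.le (pow_nonneg (by linarith [hp.2]) _), PN, Nat.add_sub_cancel]
    congr 1
    ring

theorem sizeLaw_lt (hlam : 0 < h.lam) (hr : 0 < h.r) (hF : IsGainFunction F) (y : ℝ) :
    h.sizeLaw {m | y < F m} = ENNReal.ofReal ((1 - Real.exp (-h.lam * h.r)) ^ floorInv F y) := by
  rw [← sizeLaw_Ioi hlam hr]
  refine measure_congr (ae_sizeLaw_pos.mono fun m hm => propext ?_)
  change y < F m ↔ floorInv F y < m
  rw [← not_le, ← not_le, le_floorInv_iff hF hm]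

theorem floorInv_eq_zero (hF : IsGainFunction F) {y : ℝ} (hy : y ≤ 0) : floorInv F y = 0 := by
  by_contra hne
  have := (le_floorInv_iff hF (n := 1) le_rfl y).1 (Nat.one_le_iff_ne_zero.2 hne)
  linarith [hF.pos 1 le_rfl]

theorem pow_bounds_inv_sub_one (hlam : 0 < h.lam) (hr : 0 < h.r) (G : ℕ) :
    0 < (1 - Real.exp (-h.lam * h.r)) ^ G ∧ (1 - Real.exp (-h.lam * h.r)) ^ G ≤ 1 ∧
      0 ≤ ((1 - Real.exp (-h.lam * h.r)) ^ G)⁻¹ - 1 := by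
  have hp := exp_mem_Ioo hlam hr
  have h0 : 0 < (1 - Real.exp (-h.lam * h.r)) ^ G := pow_pos (by linarith [hp.2]) _
  have h1 : (1 - Real.exp (-h.lam * h.r)) ^ G ≤ 1 :=
    pow_le_one₀ (by linarith [hp.2]) (by linarith [hp.1])
  exact ⟨h0, h1, sub_nonneg.2 ((one_le_inv₀ h0).2 h1)⟩

theorem ae_prod_snd_nonneg (hlam : 0 < h.lam) :
    ∀ᵐ w ∂(Measure.infinitePi fun _ : ℕ => h.sizeLaw.prod (expMeasure h.lam)),
      ∀ j, 0 ≤ (w j).2 := by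
  have := isProbabilityMeasure_expMeasure hlam
  have := isProbabilityMeasure_sizeLaw hlam
  exact ae_infinitePi_forall (ν := h.sizeLaw.prod (expMeasure h.lam)) (p := fun q => 0 ≤ q.2)
    (Measure.quasiMeasurePreserving_snd.ae ((ae_expMeasure_pos hlam).mono fun x hx => hx.le))

/-- The mean distance to the first westbound cluster that bridges a gap of length `x` in front of
an eastbound cluster of given size. -/
theorem lintegral_bridgeRoad (hlam : 0 < h.lam) (hr : 0 < h.r) (hF : IsGainFunction F)
    (n : ℕ) (x : ℝ) :
    ∫⁻ w, ENNReal.ofReal (bridgeRoad h.r F n w x)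
      ∂(Measure.infinitePi fun _ : ℕ => h.sizeLaw.prod (expMeasure h.lam)) =
    ENNReal.ofReal (1 / h.lam *
      (((1 - Real.exp (-h.lam * h.r)) ^ floorInv F (x / h.r - F n))⁻¹ - 1)) := by
  have := isProbabilityMeasure_expMeasure hlam
  have := isProbabilityMeasure_sizeLaw hlam
  set B : Set ℕ := {m | x / h.r - F n < F m} with hB
  have hBlaw : h.sizeLaw B = _ := sizeLaw_lt hlam hr hF (x / h.r - F n)
  obtain ⟨hq0, hq1, hq⟩ := pow_bounds_inv_sub_one hlam hr (floorInv F (x / h.r - F n))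
  set Q := (1 - Real.exp (-h.lam * h.r)) ^ floorInv F (x / h.r - F n) with hQ
  have hBc : h.sizeLaw Bᶜ = ENNReal.ofReal (1 - Q) := by
    rw [prob_compl_eq_one_sub .of_discrete, hBlaw, ← ENNReal.ofReal_one,
      ← ENNReal.ofReal_sub _ hq0.le]
  -- `A` holds the clusters too small to bridge and ignores their spacing. The integral of the
  -- spacing over `A` is therefore `(1 - Q) / λ`, and the exit probability is `Q`.
  set A : Set (ℕ × ℝ) := Bᶜ ×ˢ Set.univ with hA
  have hAm : MeasurableSet A := MeasurableSet.of_discrete.prod MeasurableSet.univ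
  have hAc : (h.sizeLaw.prod (expMeasure h.lam)) Aᶜ = ENNReal.ofReal Q := by
    have : Aᶜ = B ×ˢ Set.univ := by ext; simp [hA]
    rw [this, Measure.prod_prod, measure_univ, mul_one, hBlaw]
  have hset : ∀ w : ℕ → ℕ × ℝ, {j | x < h.r * (F n + F (w j).1)} = {j | w j ∉ A} := by
    intro w
    ext j
    simp only [hA, hB, Set.mem_ofPred_eq, Set.mem_prod, Set.mem_compl_iff, Set.mem_univ, and_true,
      not_not, sub_lt_iff_lt_add', div_lt_iff₀' hr]
  have hm : Measurable fun q : ℕ × ℝ => ENNReal.ofReal q.2 :=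
    ENNReal.measurable_ofReal.comp measurable_snd
  have hmain := lintegral_sum_range_sInf (h.sizeLaw.prod (expMeasure h.lam)) hAm
    (by rw [hAc]; simpa using hq0) hm
  rw [hAc, hA, ← Measure.prod_restrict, Measure.restrict_univ,
    lintegral_prod (fun q : ℕ × ℝ => ENNReal.ofReal q.2) hm.aemeasurable] at hmain
  simp only [lintegral_id_expMeasure hlam, lintegral_const, Measure.restrict_apply_univ] at hmain
  rw [hBc, ← ENNReal.ofReal_mul (by positivity), ← ENNReal.ofReal_div_of_pos hq0] at hmain
  rw [show 1 / h.lam * (Q⁻¹ - 1) = 1 / h.lam * (1 - Q) / Q by field_simp, ← hmain]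
  refine lintegral_congr_ae ((ae_prod_snd_nonneg hlam).mono fun w hw => ?_)
  simp only [bridgeRoad]
  rw [hset, ENNReal.ofReal_sum_of_nonneg fun j _ => hw j]

/-- The series over receiving sizes stops at `k₀`: beyond it `F k > x / r`, so the argument of the
inner `floorInv` is negative, the power is `1`, and the initial cluster already bridges. -/
theorem lintegral_lintegral_bridgeRoad (hlam : 0 < h.lam) (hr : 0 < h.r) (hF : IsGainFunction F)
    (x : ℝ) :
    ∫⁻ n, ∫⁻ w, ENNReal.ofReal (bridgeRoad h.r F n w x)
      ∂(Measure.infinitePi fun _ : ℕ => h.sizeLaw.prod (expMeasure h.lam)) ∂h.sizeLaw =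
    ENNReal.ofReal (h.meanBridgeRoad F x) := by
  simp_rw [lintegral_bridgeRoad hlam hr hF]
  have hnn : ∀ n : ℕ, 0 ≤ h.PN n / h.lam *
      (((1 - Real.exp (-h.lam * h.r)) ^ floorInv F (x / h.r - F n))⁻¹ - 1) := fun n =>
    mul_nonneg (div_nonneg (PN_pos hlam hr n).le hlam.le) (pow_bounds_inv_sub_one hlam hr _).2.2
  rw [lintegral_sizeLaw hlam hr, meanBridgeRoad,
    tsum_eq_sum (s := Finset.range (floorInv F (x / h.r))),
    ENNReal.ofReal_sum_of_nonneg fun n _ => hnn n, Finset.range_eq_Ico,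
    Finset.sum_Ico_add' (fun n => ENNReal.ofReal (h.PN n) * ENNReal.ofReal (1 / h.lam *
      (((1 - Real.exp (-h.lam * h.r)) ^ floorInv F (x / h.r - F n))⁻¹ - 1))), zero_add]
  · refine Finset.sum_congr (by ext; simp) fun n _ => ?_
    rw [← ENNReal.ofReal_mul (PN_pos hlam hr n).le]
    congr 1
    ring
  · intro k hk
    have hk' : ¬ (k + 1 ≤ floorInv F (x / h.r)) := by simpa using hk
    rw [le_floorInv_iff hF (by omega), not_le] at hk'
    rw [floorInv_eq_zero hF (by linarith)]
    simp

theorem lintegral_unbridgedGapLaw (hlam : 0 < h.lam) (hr : 0 < h.r) (hF : IsGainFunction F)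
    {f : ℝ → ℝ≥0∞} (hf : Measurable f) :
    ∫⁻ x, f x ∂h.unbridgedGapLaw F = ∑' k : ℕ, ENNReal.ofReal (h.PN (k + 1)) *
      ((ENNReal.ofReal (Real.exp (-h.lam * (h.r * F (k + 1)))))⁻¹ *
        ∫⁻ x in Set.Ioi (h.r * F (k + 1)),
          ENNReal.ofReal (h.lam * Real.exp (-h.lam * x)) * f x) := by
  rw [unbridgedGapLaw, Measure.lintegral_bind Measurable.of_discrete.aemeasurable hf.aemeasurable,
    lintegral_sizeLaw hlam hr]
  refine tsum_congr fun k => ?_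
  have hpos : 0 ≤ h.r * F (k + 1) := mul_nonneg hr.le (hF.pos _ (by omega)).le
  rw [ProbabilityTheory.cond, lintegral_smul_measure, expMeasure_Ioi hlam hpos, smul_eq_mul,
    ← lintegral_indicator measurableSet_Ioi, lintegral_expMeasure _ (hf.indicator measurableSet_Ioi)]
  congr 2
  have : ∀ x, ENNReal.ofReal (h.lam * Real.exp (-h.lam * x)) *
      (Set.Ioi (h.r * F (k + 1))).indicator f x = (Set.Ioi (h.r * F (k + 1))).indicator
        (fun x => ENNReal.ofReal (h.lam * Real.exp (-h.lam * x)) * f x) x := fun x => by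
    by_cases hx : x ∈ Set.Ioi (h.r * F (k + 1)) <;> simp [hx]
  simp_rw [this]
  rw [lintegral_indicator measurableSet_Ioi, Measure.restrict_restrict measurableSet_Ioi,
    Set.inter_eq_left.2 (Set.Ioi_subset_Ioi hpos)]

/-- The factor `e^{-λ r}` of `PN` is absorbed into the conditioning denominator, which is why `F -
1` appears in `meanGap`. -/
theorem lintegral_id_unbridgedGapLaw (hlam : 0 < h.lam) (hr : 0 < h.r) (hF : IsGainFunction F) :
    ∫⁻ x, ENNReal.ofReal x ∂h.unbridgedGapLaw F = h.meanGap F := by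
  rw [lintegral_unbridgedGapLaw hlam hr hF ENNReal.measurable_ofReal, meanGap]
  refine tsum_congr fun k => ?_
  have hpos : 0 ≤ h.r * F (k + 1) := mul_nonneg hr.le (hF.pos _ (by omega)).le
  have hp := exp_mem_Ioo hlam hr
  have hq : 0 ≤ (1 - Real.exp (-h.lam * h.r)) ^ k := pow_nonneg (by linarith [hp.2]) _
  have hint : ∫⁻ x in Set.Ioi (h.r * F (k + 1)),
      ENNReal.ofReal (h.lam * Real.exp (-h.lam * x)) * ENNReal.ofReal x =
      ∫⁻ x in Set.Ioi (h.r * F (k + 1)), ENNReal.ofReal (x * h.lam * Real.exp (-h.lam * x)) := by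
    refine lintegral_congr fun x => ?_
    rw [← ENNReal.ofReal_mul (by positivity)]
    ring_nf
  rw [hint, ← mul_assoc (ENNReal.ofReal _), ENNReal.div_eq_inv_mul,
    ← mul_assoc (ENNReal.ofReal _)⁻¹]
  congr 1
  rw [← ENNReal.ofReal_inv_of_pos (Real.exp_pos _), ← ENNReal.ofReal_inv_of_pos (Real.exp_pos _),
    ← ENNReal.ofReal_mul (PN_pos hlam hr _).le, ← ENNReal.ofReal_mul' (by positivity), PN,
    Nat.add_sub_cancel, ← Real.exp_neg, ← Real.exp_neg, mul_right_comm, ← Real.exp_add]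
  congr 3
  ring

/-- This identifies `gapDensity` as the density of the gap law. Conditioning on the open half-line
agrees with the closed one in the density since endpoints are Lebesgue null. -/
theorem lintegral_unbridgedGapLaw_eq_gapDensity (hlam : 0 < h.lam) (hr : 0 < h.r)
    (hF : IsGainFunction F) {f : ℝ → ℝ≥0∞} (hf : Measurable f) :
    ∫⁻ x, f x ∂h.unbridgedGapLaw F = ∫⁻ x in Set.Ioi (0 : ℝ), f x * h.gapDensity F x := by
  rw [lintegral_unbridgedGapLaw hlam hr hF hf]
  simp_rw [gapDensity, ← ENNReal.tsum_mul_left]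
  rw [lintegral_tsum]
  · refine tsum_congr fun k => ?_
    have hpos : 0 < h.r * F (k + 1) := mul_pos hr (hF.pos _ (by omega))
    have hexp := Real.exp_pos (-h.lam * (h.r * F (k + 1)))
    have hind : ∀ x, f x * ENNReal.ofReal (h.PN (k + 1) * (if h.r * F (k + 1) ≤ x then
        h.lam * Real.exp (-h.lam * x) / Real.exp (-h.lam * h.r * F (k + 1)) else 0)) =
        (Set.Ici (h.r * F (k + 1))).indicator (fun x => ENNReal.ofReal (h.PN (k + 1)) *
          (ENNReal.ofReal (Real.exp (-h.lam * (h.r * F (k + 1)))))⁻¹ *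
          (ENNReal.ofReal (h.lam * Real.exp (-h.lam * x)) * f x)) x := by
      intro x
      by_cases hx : h.r * F (k + 1) ≤ x
      · rw [if_pos hx, Set.indicator_of_mem (Set.mem_Ici.2 hx), ENNReal.ofReal_mul
          (PN_pos hlam hr _).le, mul_assoc (-h.lam), ENNReal.ofReal_div_of_pos hexp,
          ENNReal.div_eq_inv_mul]
        ring
      · rw [if_neg hx, Set.indicator_of_notMem (by simpa using hx)]
        simp
    simp_rw [hind]
    rw [lintegral_indicator measurableSet_Ici, Measure.restrict_restrict measurableSet_Ici,
      Set.inter_eq_left.2 (Set.Ici_subset_Ioi.2 hpos),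
      setLIntegral_congr Ioi_ae_eq_Ici.symm, lintegral_const_mul, mul_assoc]
    fun_prop
  · intro k
    refine (hf.mul (ENNReal.measurable_ofReal.comp (measurable_const.mul
      (Measurable.ite measurableSet_Ici ?_ measurable_const)))).aemeasurable
    fun_prop

theorem isProbabilityMeasure_unbridgedGapLaw (hlam : 0 < h.lam) (hr : 0 < h.r)
    (hF : IsGainFunction F) : IsProbabilityMeasure (h.unbridgedGapLaw F) := by
  have := isProbabilityMeasure_sizeLaw hlam
  have := isProbabilityMeasure_expMeasure hlam
  refine ⟨?_⟩
  rw [unbridgedGapLaw, Measure.bind_apply MeasurableSet.univ Measurable.of_discrete.aemeasurable,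
    lintegral_congr_ae (g := fun _ => 1)]
  · simp
  · refine ae_sizeLaw_pos.mono fun n hn => ?_
    have : IsProbabilityMeasure (ProbabilityTheory.cond (expMeasure h.lam) (Set.Ioi (h.r * F n))) :=
      cond_isProbabilityMeasure (by
        rw [expMeasure_Ioi hlam (mul_nonneg hr.le (hF.pos n hn).le)]
        simpa using Real.exp_pos _)
    exact measure_univ

theorem ae_unbridgedGapLaw_nonneg (hlam : 0 < h.lam) (hr : 0 < h.r) (hF : IsGainFunction F) :
    ∀ᵐ x ∂h.unbridgedGapLaw F, 0 ≤ x := by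
  have h0 : ∫⁻ x, (Set.Iio (0 : ℝ)).indicator 1 x ∂h.unbridgedGapLaw F = 0 := by
    rw [lintegral_unbridgedGapLaw_eq_gapDensity hlam hr hF
      (measurable_one.indicator measurableSet_Iio),
      setLIntegral_congr_fun (g := fun _ => 0) measurableSet_Ioi]
    · simp
    · intro x hx
      have : x ∉ Set.Iio (0 : ℝ) := by simpa using (Set.mem_Ioi.1 hx).le
      simp [Set.indicator_of_notMem this]
  rw [lintegral_indicator_one measurableSet_Iio] at h0
  rw [ae_iff]
  convert h0 using 2
  ext; simp

/-- Length of the gap, distance to the first westbound cluster, size of the receiving cluster, and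
westbound road. -/
abbrev WaitData := ℝ × ℝ × ℕ × (ℕ → ℕ × ℝ)

theorem measurable_bridgeRoad {α : Type*} [MeasurableSpace α] (r : ℝ) (F : ℕ → ℝ) {n : α → ℕ}
    {w : α → ℕ → ℕ × ℝ} {x : α → ℝ} (hn : Measurable n) (hw : Measurable w) (hx : Measurable x) :
    Measurable fun a => bridgeRoad r F (n a) (w a) (x a) := by
  have hF : Measurable F := Measurable.of_discrete
  have hw' : ∀ j : ℕ, Measurable fun a => w a j := fun j => (measurable_pi_apply j).comp hw
  refine measurable_sum_range (measurable_sInf_setOf fun j => ?_)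
    fun j => measurable_snd.comp (hw' j)
  exact measurableSet_lt hx (measurable_const.mul
    ((hF.comp hn).add (hF.comp (measurable_fst.comp (hw' j)))))

/-- The joint law of the gap, the distance to the first westbound cluster, the size of the
receiving cluster and the westbound road. -/
noncomputable def waitDataLaw (h : Highway) (F : ℕ → ℝ) : Measure WaitData :=
  (h.unbridgedGapLaw F).prod ((expMeasure h.lam).prod (h.sizeLaw.prod
      (Measure.infinitePi fun _ : ℕ => h.sizeLaw.prod (expMeasure h.lam))))

theorem measurable_waitTime (h : Highway) (F : ℕ → ℝ) : Measurable fun q : WaitData =>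
    (q.1 + q.2.1 + bridgeRoad h.r F q.2.2.1 q.2.2.2 q.1) / (2 * h.v) :=
  ((measurable_fst.add measurable_snd.fst).add (measurable_bridgeRoad _ _
    measurable_snd.snd.fst measurable_snd.snd.snd measurable_fst)).div_const _

theorem ae_waitDataLaw_nonneg (hlam : 0 < h.lam) (hr : 0 < h.r) (hF : IsGainFunction F) :
    ∀ᵐ q ∂h.waitDataLaw F, 0 ≤ q.1 ∧ 0 ≤ q.2.1 ∧ 0 ≤ bridgeRoad h.r F q.2.2.1 q.2.2.2 q.1 := by
  have := isProbabilityMeasure_sizeLaw hlam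
  have := isProbabilityMeasure_expMeasure hlam
  have := isProbabilityMeasure_unbridgedGapLaw hlam hr hF
  have h1 : ∀ᵐ q ∂h.waitDataLaw F, 0 ≤ q.1 :=
    Measure.quasiMeasurePreserving_fst.ae (ae_unbridgedGapLaw_nonneg hlam hr hF)
  have h2 : ∀ᵐ q ∂h.waitDataLaw F, 0 < q.2.1 := Measure.quasiMeasurePreserving_snd.ae
    (Measure.quasiMeasurePreserving_fst.ae (ae_expMeasure_pos hlam))
  have h3 : ∀ᵐ q ∂h.waitDataLaw F, ∀ j, 0 ≤ (q.2.2.2 j).2 := Measure.quasiMeasurePreserving_snd.ae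
    (Measure.quasiMeasurePreserving_snd.ae
      (Measure.quasiMeasurePreserving_snd.ae (ae_prod_snd_nonneg hlam)))
  filter_upwards [h1, h2, h3] with q hq1 hq2 hq3
  exact ⟨hq1, hq2.le, Finset.sum_nonneg fun j _ => hq3 j⟩

theorem ae_waitLaw_nonneg (hlam : 0 < h.lam) (hr : 0 < h.r) (hv : 0 < h.v)
    (hF : IsGainFunction F) : ∀ᵐ x ∂h.waitLaw F, 0 ≤ x := by
  rw [waitLaw, ae_map_iff (measurable_waitTime h F).aemeasurable measurableSet_Ici]
  refine (ae_waitDataLaw_nonneg hlam hr hF).mono fun q hq => ?_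
  have := hq.1
  have := hq.2.1
  have := hq.2.2
  positivity

theorem lintegral_bridgeRoad_waitDataLaw (hlam : 0 < h.lam) (hr : 0 < h.r)
    (hF : IsGainFunction F) :
    ∫⁻ q, ENNReal.ofReal (bridgeRoad h.r F q.2.2.1 q.2.2.2 q.1) ∂h.waitDataLaw F =
      ∫⁻ x in Set.Ioi (0 : ℝ), ENNReal.ofReal (h.meanBridgeRoad F x) * h.gapDensity F x := by
  have := isProbabilityMeasure_sizeLaw hlam
  have := isProbabilityMeasure_expMeasure hlam
  have := isProbabilityMeasure_unbridgedGapLaw hlam hr hF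
  have hB : Measurable fun q : WaitData =>
      ENNReal.ofReal (bridgeRoad h.r F q.2.2.1 q.2.2.2 q.1) :=
    (measurable_bridgeRoad h.r F measurable_snd.snd.fst measurable_snd.snd.snd
      measurable_fst).ennreal_ofReal
  have hin : ∀ x, ∫⁻ y : ℝ × ℕ × (ℕ → ℕ × ℝ),
      ENNReal.ofReal (bridgeRoad h.r F y.2.1 y.2.2 x) ∂((expMeasure h.lam).prod (h.sizeLaw.prod
        (Measure.infinitePi fun _ : ℕ => h.sizeLaw.prod (expMeasure h.lam)))) =
      ENNReal.ofReal (h.meanBridgeRoad F x) := by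
    intro x
    have hx : Measurable fun y : ℕ × (ℕ → ℕ × ℝ) =>
        ENNReal.ofReal (bridgeRoad h.r F y.1 y.2 x) :=
      (measurable_bridgeRoad h.r F measurable_fst measurable_snd measurable_const).ennreal_ofReal
    refine (measurePreserving_snd.lintegral_comp hx).trans ?_
    rw [lintegral_prod (fun y : ℕ × (ℕ → ℕ × ℝ) => ENNReal.ofReal (bridgeRoad h.r F y.1 y.2 x))
      hx.aemeasurable]
    exact lintegral_lintegral_bridgeRoad hlam hr hF x
  -- Tonelli supplies the measurability of `meanBridgeRoad` in `x`, once `hin` identifies the inner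
  -- integral, without an inspection of `floorInv`.
  have hmeas := hB.lintegral_prod_right' (ν := (expMeasure h.lam).prod (h.sizeLaw.prod
        (Measure.infinitePi fun _ : ℕ => h.sizeLaw.prod (expMeasure h.lam))))
  rw [waitDataLaw, lintegral_prod (fun q : WaitData =>
      ENNReal.ofReal (bridgeRoad h.r F q.2.2.1 q.2.2.2 q.1)) hB.aemeasurable]
  simp only [hin] at hmeas ⊢
  exact lintegral_unbridgedGapLaw_eq_gapDensity hlam hr hF hmeas

theorem lintegral_waitLaw (hlam : 0 < h.lam) (hr : 0 < h.r) (hv : 0 < h.v)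
    (hF : IsGainFunction F) : ∫⁻ x, ENNReal.ofReal x ∂h.waitLaw F = h.meanWait F := by
  have := isProbabilityMeasure_sizeLaw hlam
  have := isProbabilityMeasure_expMeasure hlam
  have := isProbabilityMeasure_unbridgedGapLaw hlam hr hF
  have hB : Measurable fun q : WaitData =>
      ENNReal.ofReal (bridgeRoad h.r F q.2.2.1 q.2.2.2 q.1) :=
    (measurable_bridgeRoad h.r F measurable_snd.snd.fst measurable_snd.snd.snd
      measurable_fst).ennreal_ofReal
  have hm1 : Measurable fun q : WaitData => ENNReal.ofReal q.1 :=
    ENNReal.measurable_ofReal.comp measurable_fst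
  have hm2 : Measurable fun q : WaitData => ENNReal.ofReal q.2.1 :=
    ENNReal.measurable_ofReal.comp measurable_snd.fst
  have hm12 : Measurable fun q : WaitData => ENNReal.ofReal q.1 + ENNReal.ofReal q.2.1 :=
    hm1.add hm2
  have hm123 : Measurable fun q : WaitData => ENNReal.ofReal q.1 + ENNReal.ofReal q.2.1 +
      ENNReal.ofReal (bridgeRoad h.r F q.2.2.1 q.2.2.2 q.1) := hm12.add hB
  have e1 : ∫⁻ q, ENNReal.ofReal q.1 ∂h.waitDataLaw F = h.meanGap F :=
    (measurePreserving_fst.lintegral_comp ENNReal.measurable_ofReal).trans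
      (lintegral_id_unbridgedGapLaw hlam hr hF)
  have e2 : ∫⁻ q, ENNReal.ofReal q.2.1 ∂h.waitDataLaw F = ENNReal.ofReal (1 / h.lam) :=
    (measurePreserving_snd.lintegral_comp
      (f := fun y : ℝ × ℕ × (ℕ → ℕ × ℝ) => ENNReal.ofReal y.1)
      (ENNReal.measurable_ofReal.comp measurable_fst)).trans
      ((measurePreserving_fst.lintegral_comp ENNReal.measurable_ofReal).trans
        (lintegral_id_expMeasure hlam))
  have e3 := lintegral_bridgeRoad_waitDataLaw hlam hr hF
  rw [waitLaw, lintegral_map ENNReal.measurable_ofReal (measurable_waitTime h F)]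
  change ∫⁻ q, _ ∂h.waitDataLaw F = _
  rw [meanWait, ← e1, ← e2, ← e3, ← lintegral_add_left hm1, ← lintegral_add_left hm12,
    div_eq_mul_inv, ← lintegral_mul_const _ hm123]
  refine lintegral_congr_ae ((ae_waitDataLaw_nonneg hlam hr hF).mono fun q hq => ?_)
  simp only
  rw [ENNReal.ofReal_div_of_pos (by positivity), ENNReal.ofReal_add (add_nonneg hq.1 hq.2.1) hq.2.2,
    ENNReal.ofReal_add hq.1 hq.2.1, div_eq_mul_inv]

end HighwayIPS.Highway

/-! ### Outage and the transmission time. -/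

instance : IsProbabilityMeasure complexGaussian :=
  Measure.isProbabilityMeasure_map (by fun_prop)

instance : IsProbabilityMeasure scatterLaw := by
  unfold scatterLaw; infer_instance

/-- The real part already has no atoms. This excludes the fading value at which the scattered
component cancels the direct one. -/
theorem ae_complexGaussian_ne (c : ℂ) : ∀ᵐ z ∂complexGaussian, z ≠ c := by
  have : NullSingletonClass (gaussianReal 0 (1 / 2)) :=
    nullSingletonClass_gaussianReal (by norm_num)
  refine (ae_map_iff (by fun_prop) (measurableSet_singleton c).compl).2 ?_
  have h0 : ∀ᵐ x ∂gaussianReal 0 (1 / 2), x ≠ c.re := by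
    simpa [ae_iff] using measure_singleton (μ := gaussianReal 0 (1 / 2)) c.re
  refine (Measure.quasiMeasurePreserving_fst.ae h0).mono fun p hp he => hp ?_
  rw [← he]; simp

namespace HighwayIPS.Highway

variable {h : Highway}

theorem measurableSet_linkFails (h : Highway) :
    MeasurableSet {q : ℝ × ℂ × ℂ | h.LinkFails q.1 q.2} := by
  refine measurableSet_lt ?_ measurable_const
  fun_prop

theorem measurableSet_outage (h : Highway) : MeasurableSet {a : Attempt | h.Outage a} := by
  have : {a : Attempt | h.Outage a} =
      ⋂ k : ℕ, {a : Attempt | k < a.1}ᶜ ∪ {a : Attempt | h.LinkFails a.2.1 (a.2.2 k)} := by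
    ext a
    simp [Outage, imp_iff_not_or]
  rw [this]
  refine MeasurableSet.iInter fun k => MeasurableSet.union ?_ ?_
  · exact (measurableSet_lt measurable_const measurable_fst).compl
  · exact (measurableSet_linkFails h).preimage (measurable_snd.fst.prodMk
      ((measurable_pi_apply k).comp measurable_snd.snd))

theorem isProbabilityMeasure_attemptLaw (hlam : 0 < h.lam) :
    IsProbabilityMeasure h.attemptLaw := by
  have := isProbabilityMeasure_expMeasure hlam
  have := isProbabilityMeasure_sizeLaw hlam
  unfold attemptLaw
  infer_instance

theorem measurable_outageProb (h : Highway) (k : ℕ) : Measurable (h.outageProb k) :=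
  (measurable_measure_prodMk_left (ν := scatterLaw) (measurableSet_linkFails h)).ennreal_toReal.pow_const
    k

theorem outageProb_mem_Icc (h : Highway) (k : ℕ) (x : ℝ) : h.outageProb k x ∈ Set.Icc (0 : ℝ) 1 :=
  ⟨pow_nonneg measureReal_nonneg _, pow_le_one₀ measureReal_nonneg measureReal_le_one⟩

theorem meanOutage_nonneg (h : Highway) (k : ℕ) : 0 ≤ h.meanOutage k :=
  integral_nonneg fun x => (outageProb_mem_Icc h k x).1

theorem lintegral_outageProb (hlam : 0 < h.lam) (k : ℕ) :
    ∫⁻ x, ENNReal.ofReal (h.outageProb k x) ∂(expMeasure h.lam) =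
      ENNReal.ofReal (h.meanOutage k) := by
  have := isProbabilityMeasure_expMeasure hlam
  refine (ofReal_integral_eq_lintegral_ofReal ?_
    (ae_of_all _ fun x => (outageProb_mem_Icc h k x).1)).symm
  refine Integrable.of_bound (measurable_outageProb h k).aestronglyMeasurable 1
    (ae_of_all _ fun x => ?_)
  rw [Real.norm_of_nonneg (outageProb_mem_Icc h k x).1]
  exact (outageProb_mem_Icc h k x).2

theorem meanOutage_le_one (hlam : 0 < h.lam) (k : ℕ) : h.meanOutage k ≤ 1 := by
  have := isProbabilityMeasure_expMeasure hlam
  rw [← ENNReal.ofReal_le_one, ← lintegral_outageProb hlam]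
  calc ∫⁻ x, ENNReal.ofReal (h.outageProb k x) ∂(expMeasure h.lam)
      ≤ ∫⁻ _, 1 ∂(expMeasure h.lam) :=
        lintegral_mono fun x => ENNReal.ofReal_le_one.2 (outageProb_mem_Icc h k x).2
    _ = 1 := by simp

/-- The probability that an attempt is in outage. -/
noncomputable def meanAttemptOutage (h : Highway) : ℝ := ∑' k : ℕ, h.PN (k + 1) * h.meanOutage (k + 1)

/-- Given the size and the distance, the links fail independently with equal probability; hence the
power in `outageProb`. -/
theorem attemptLaw_outage (hlam : 0 < h.lam) (hr : 0 < h.r) :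
    h.attemptLaw {a | h.Outage a} = ENNReal.ofReal h.meanAttemptOutage := by
  have := isProbabilityMeasure_expMeasure hlam
  have := isProbabilityMeasure_sizeLaw hlam
  have hO := measurableSet_outage h
  rw [meanAttemptOutage, ← (lintegral_sizeLaw_ofReal hlam hr (fun k _ => meanOutage_nonneg h k)
    fun k _ => meanOutage_le_one hlam k).2, attemptLaw, Measure.prod_apply hO]
  refine lintegral_congr fun n => ?_
  rw [Measure.prod_apply (measurable_prodMk_left hO), ← lintegral_outageProb hlam]
  refine lintegral_congr fun x => ?_
  have hx : MeasurableSet {g | h.LinkFails x g} :=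
    measurable_prodMk_left (x := x) (measurableSet_linkFails h)
  have hset : Prod.mk x ⁻¹' (Prod.mk n ⁻¹' {a : Attempt | h.Outage a}) =
      (Finset.range n : Set ℕ).pi fun _ => {g | h.LinkFails x g} := by
    ext ψ; simp [Outage]
  rw [hset, Measure.infinitePi_pi _ fun _ _ => hx,
    Finset.prod_const, Finset.card_range, outageProb, ENNReal.ofReal_pow measureReal_nonneg,
    ofReal_measureReal]

/-- If outage were almost sure, the first receiver would fail for almost every distance and fading.
Fixing a fading with nonzero signal contradicts this, since the path loss factor blows up at short
distances, which have positive probability. -/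
theorem attemptLaw_compl_outage_ne_zero (hlam : 0 < h.lam) (hK : 0 < h.K) (hPt : 0 < h.Pt)
    (hPmin : 0 < h.Pmin) (hdel : 0 < h.del) : h.attemptLaw {a | h.Outage a}ᶜ ≠ 0 := by
  have := isProbabilityMeasure_expMeasure hlam
  have := isProbabilityMeasure_sizeLaw hlam
  intro h0
  have hae : ∀ᵐ a ∂h.attemptLaw, h.Outage a := h0
  obtain ⟨n, hn, hn1⟩ := ((Measure.ae_ae_of_ae_prod hae).and ae_sizeLaw_pos).exists
  have hx : ∀ᵐ x ∂expMeasure h.lam, ∀ᵐ g ∂scatterLaw, h.LinkFails x g := by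
    refine (Measure.ae_ae_of_ae_prod hn).mono fun x hx => ?_
    have hxm : MeasurableSet {g | h.LinkFails x g} :=
      measurable_prodMk_left (x := x) (measurableSet_linkFails h)
    rw [← Measure.infinitePi_map_eval (fun _ : ℕ => scatterLaw) 0]
    exact (ae_map_iff (measurable_pi_apply 0).aemeasurable hxm).2 (hx.mono fun ψ hψ => hψ 0 hn1)
  have hs : 0 < h.sigma := Real.sqrt_pos.2 (by positivity)
  have hg : ∀ᵐ g ∂scatterLaw, g.1 ≠ -(1 / (h.sigma : ℂ)) :=
    Measure.quasiMeasurePreserving_fst.ae (ae_complexGaussian_ne _)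
  -- Exchanging the two almost-everywhere quantifiers lets the fading be fixed before the distance
  -- varies.
  obtain ⟨g, hg0, hgx⟩ := (hg.and ((Measure.ae_ae_comm (measurableSet_linkFails h)).1 hx)).exists
  set s := ‖1 + (h.sigma : ℂ) * g.1‖ ^ 2 + ‖1 + (h.sigma : ℂ) * g.2‖ ^ 2 with hsdef
  have hspos : 0 < s := by
    have h1 : 1 + (h.sigma : ℂ) * g.1 ≠ 0 := by
      intro he
      have hs' : (h.sigma : ℂ) ≠ 0 := by exact_mod_cast hs.ne'
      refine hg0 ?_
      field_simp
      linear_combination he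
    have := norm_pos_iff.2 h1
    positivity
  set c := h.Pmin / (h.K * h.Pt / (h.K + 1) * s) with hc
  have hcpos : 0 < c := by positivity
  -- At distance `ε` the received power equals `Pmin` exactly; at any smaller positive distance it
  -- is larger.
  set ε := c ^ (-(1 / h.del)) with hε
  have hεpos : 0 < ε := Real.rpow_pos_of_pos hcpos _
  have hfreq : ∃ᵐ x ∂expMeasure h.lam, x < ε := by
    intro hnot
    have h1 : expMeasure h.lam (Set.Iio ε) = 0 := by
      rw [ae_iff] at hnot
      exact measure_mono_null (fun y hy => by simpa using hy) hnot
    rw [expMeasure_Iio hlam hεpos.le, ENNReal.ofReal_eq_zero, sub_nonpos, Real.one_le_exp_iff] at h1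
    nlinarith [mul_pos hlam hεpos]
  obtain ⟨x, hxε, hx0, hxf⟩ := (hfreq.and_eventually ((ae_expMeasure_pos hlam).and hgx)).exists
  have hlt := Real.rpow_lt_rpow_of_neg hx0 hxε (neg_lt_zero.2 hdel)
  rw [hε, ← Real.rpow_mul hcpos.le, neg_mul_neg, one_div_mul_cancel hdel.ne', Real.rpow_one, hc,
    div_lt_iff₀ (by positivity)] at hlt
  have hxf' : h.K * h.Pt / (h.K + 1) * x ^ (-h.del) * s < h.Pmin := hxf
  linarith [mul_right_comm (h.K * h.Pt / (h.K + 1)) (x ^ (-h.del)) s,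
    mul_comm (x ^ (-h.del)) (h.K * h.Pt / (h.K + 1) * s)]

theorem attemptLaw_compl_outage (hlam : 0 < h.lam) (hr : 0 < h.r) (hK : 0 < h.K) (hPt : 0 < h.Pt)
    (hPmin : 0 < h.Pmin) (hdel : 0 < h.del) :
    h.attemptLaw {a | h.Outage a}ᶜ = ENNReal.ofReal (1 - h.meanAttemptOutage) ∧
      0 < 1 - h.meanAttemptOutage := by
  have := isProbabilityMeasure_attemptLaw hlam
  have h1 : h.attemptLaw {a | h.Outage a}ᶜ = ENNReal.ofReal (1 - h.meanAttemptOutage) := by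
    rw [prob_compl_eq_one_sub (measurableSet_outage h), attemptLaw_outage hlam hr,
      ← ENNReal.ofReal_one, ← ENNReal.ofReal_sub]
    exact tsum_nonneg fun k => mul_nonneg (PN_pos hlam hr _).le (meanOutage_nonneg h _)
  refine ⟨h1, ?_⟩
  have := attemptLaw_compl_outage_ne_zero hlam hK hPt hPmin hdel
  rw [h1] at this
  simpa using this

theorem measurable_numAttempts (h : Highway) : Measurable h.numAttempts :=
  (measurable_sInf_setOf fun j =>
    (measurableSet_outage h).compl.preimage (measurable_pi_apply j)).add_const 1

/-- The failures form a stopped sum with `f = 1`; adding the final success gives `p / (1 - p) + 1 =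
1 / (1 - p)` for outage probability `p`. -/
theorem lintegral_numAttempts (hlam : 0 < h.lam) (hr : 0 < h.r) (hK : 0 < h.K) (hPt : 0 < h.Pt)
    (hPmin : 0 < h.Pmin) (hdel : 0 < h.del) :
    ∫⁻ a, ENNReal.ofReal (h.numAttempts a) ∂(Measure.infinitePi fun _ : ℕ => h.attemptLaw) =
      ENNReal.ofReal (1 / (1 - h.meanAttemptOutage)) := by
  have := isProbabilityMeasure_attemptLaw hlam
  have hO := measurableSet_outage h
  obtain ⟨hc, hpos⟩ := attemptLaw_compl_outage hlam hr hK hPt hPmin hdel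
  have hne := attemptLaw_compl_outage_ne_zero hlam hK hPt hPmin hdel
  have hmain := lintegral_sum_range_sInf h.attemptLaw hO hne (f := fun _ => 1) measurable_const
  have e : ∀ a : ℕ → Attempt, ENNReal.ofReal (h.numAttempts a) =
      (∑ j ∈ Finset.range (sInf {j | a j ∉ {a | h.Outage a}}), 1) + 1 := by
    intro a
    rw [ENNReal.ofReal_natCast, numAttempts]
    simp
  simp_rw [e]
  rw [lintegral_add_right _ measurable_const, hmain, setLIntegral_const, lintegral_const,
    measure_univ, one_mul, one_mul,
    ← ENNReal.div_self hne (measure_ne_top _ _), ENNReal.div_add_div_same,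
    measure_add_measure_compl hO, measure_univ, hc, ENNReal.ofReal_div_of_pos hpos,
    ENNReal.ofReal_one]

theorem measurable_transmitTime (h : Highway) :
    Measurable fun q : Bool × (ℕ → Attempt) × (ℕ → Attempt) =>
      h.tau * ((h.numAttempts q.2.1 : ℝ) + if q.1 then (h.numAttempts q.2.2 : ℝ) else 0) := by
  have hN : Measurable fun a => (h.numAttempts a : ℝ) :=
    Measurable.of_discrete.comp (measurable_numAttempts h)
  refine measurable_const.mul ((hN.comp measurable_snd.fst).add (Measurable.ite ?_
    (hN.comp measurable_snd.snd) measurable_const))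
  exact measurable_fst (MeasurableSet.of_discrete (s := {true}))

theorem ae_transmitLaw_nonneg (htau : 0 < h.tau) : ∀ᵐ x ∂h.transmitLaw, 0 ≤ x := by
  rw [transmitLaw, ae_map_iff (measurable_transmitTime h).aemeasurable measurableSet_Ici]
  refine ae_of_all _ fun q => ?_
  split_ifs <;> positivity

theorem lintegral_transmitLaw (hlam : 0 < h.lam) (hr : 0 < h.r) (htau : 0 < h.tau) (hK : 0 < h.K)
    (hPt : 0 < h.Pt) (hPmin : 0 < h.Pmin) (hdel : 0 < h.del) :
    ∫⁻ x, ENNReal.ofReal x ∂h.transmitLaw = ENNReal.ofReal h.meanTransmit := by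
  have := isProbabilityMeasure_attemptLaw hlam
  obtain ⟨-, hpos⟩ := attemptLaw_compl_outage hlam hr hK hPt hPmin hdel
  have hN : Measurable fun a => ENNReal.ofReal (h.numAttempts a) :=
    ENNReal.measurable_ofReal.comp (Measurable.of_discrete.comp (measurable_numAttempts h))
  have hm := measurable_transmitTime h
  have hone := lintegral_numAttempts hlam hr hK hPt hPmin hdel
  set m := 1 / (1 - h.meanAttemptOutage) with hmdef
  have hN1 : Measurable fun p : (ℕ → Attempt) × (ℕ → Attempt) =>
      ENNReal.ofReal (h.numAttempts p.1) := hN.comp measurable_fst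
  have hN2 : Measurable fun p : (ℕ → Attempt) × (ℕ → Attempt) =>
      ENNReal.ofReal (h.numAttempts p.2) := hN.comp measurable_snd
  have hN12 : Measurable fun p : (ℕ → Attempt) × (ℕ → Attempt) =>
      ENNReal.ofReal (h.numAttempts p.1) + ENNReal.ofReal (h.numAttempts p.2) := hN1.add hN2
  have hm0 : 0 < m := one_div_pos.2 hpos
  rw [transmitLaw, lintegral_map ENNReal.measurable_ofReal hm,
    lintegral_prod _ hm.ennreal_ofReal.aemeasurable, lintegral_uniformOfFintype_bool]
  simp only [if_true, Bool.false_eq_true, if_false, add_zero]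
  have e1 : ∀ p : (ℕ → Attempt) × (ℕ → Attempt),
      ENNReal.ofReal (h.tau * ((h.numAttempts p.1 : ℝ) + (h.numAttempts p.2 : ℝ))) =
      ENNReal.ofReal h.tau * (ENNReal.ofReal (h.numAttempts p.1) +
        ENNReal.ofReal (h.numAttempts p.2)) := fun p => by
    rw [ENNReal.ofReal_mul htau.le, ENNReal.ofReal_add (by positivity) (by positivity)]
  have e2 : ∀ p : (ℕ → Attempt) × (ℕ → Attempt),
      ENNReal.ofReal (h.tau * (h.numAttempts p.1 : ℝ)) =
      ENNReal.ofReal h.tau * ENNReal.ofReal (h.numAttempts p.1) := fun p =>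
    ENNReal.ofReal_mul htau.le
  have i1 : ∫⁻ p : (ℕ → Attempt) × (ℕ → Attempt), ENNReal.ofReal (h.numAttempts p.1)
      ∂((Measure.infinitePi fun _ : ℕ => h.attemptLaw).prod
        (Measure.infinitePi fun _ : ℕ => h.attemptLaw)) = ENNReal.ofReal m :=
    (measurePreserving_fst.lintegral_comp hN).trans hone
  have i2 : ∫⁻ p : (ℕ → Attempt) × (ℕ → Attempt), ENNReal.ofReal (h.numAttempts p.2)
      ∂((Measure.infinitePi fun _ : ℕ => h.attemptLaw).prod
        (Measure.infinitePi fun _ : ℕ => h.attemptLaw)) = ENNReal.ofReal m :=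
    (measurePreserving_snd.lintegral_comp hN).trans hone
  simp_rw [e1, e2]
  rw [lintegral_const_mul _ hN12, lintegral_const_mul _ hN1, lintegral_add_left hN1, i1, i2, ← ENNReal.ofReal_add hm0.le hm0.le, ← ENNReal.ofReal_mul htau.le,
    ← ENNReal.ofReal_mul htau.le, ← ENNReal.ofReal_ofNat 2, ← ENNReal.ofReal_div_of_pos two_pos,
    ← ENNReal.ofReal_div_of_pos two_pos, ← ENNReal.ofReal_add (by positivity) (by positivity),
    meanTransmit, ← meanAttemptOutage, ← hmdef]
  ring_nf

theorem meanTransmit_pos (hlam : 0 < h.lam) (hr : 0 < h.r) (htau : 0 < h.tau) (hK : 0 < h.K)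
    (hPt : 0 < h.Pt) (hPmin : 0 < h.Pmin) (hdel : 0 < h.del) : 0 < h.meanTransmit := by
  have := one_div_pos.2 (attemptLaw_compl_outage hlam hr hK hPt hPmin hdel).2
  rw [meanTransmit, ← meanAttemptOutage]
  positivity

end HighwayIPS.Highway

/-! ### Renewal reward limits. -/

/-- The deterministic part of the renewal reward theorem. -/
theorem HighwayIPS.IsPropagation.tendsto_div {Tw Tt D : ℕ → ℝ} {x : ℝ → ℝ}
    (hx : IsPropagation Tw Tt D x) (hTw : ∀ i, 0 ≤ Tw i) (hTt : ∀ i, 0 ≤ Tt i)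
    (hD : ∀ i, 0 ≤ D i)
    (hS : Tendsto (fun n => ∑ i ∈ Finset.range n, (Tw i + Tt i)) atTop atTop) {d γ : ℝ}
    (hd : Tendsto (fun n : ℕ => (∑ i ∈ Finset.range n, D i) / n) atTop (𝓝 d))
    (hγ : Tendsto (fun n : ℕ => n / ∑ i ∈ Finset.range n, (Tw i + Tt i)) atTop (𝓝 γ)) :
    Tendsto (fun t => x t / t) atTop (𝓝 (d * γ)) := by
  set S : ℕ → ℝ := fun n => ∑ i ∈ Finset.range n, (Tw i + Tt i) with hSdef
  set R : ℕ → ℝ := fun n => ∑ i ∈ Finset.range n, D i with hRdef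
  have hSsucc : ∀ n, S (n + 1) = S n + Tw n + Tt n := fun n => by
    simp only [hSdef, Finset.sum_range_succ]; ring
  have hRsucc : ∀ n, R (n + 1) = R n + D n := fun n => Finset.sum_range_succ _ _
  have hSmono : Monotone S := monotone_nat_of_le_succ fun n => by
    rw [hSsucc]; linarith [hTw n, hTt n]
  have hR0 : ∀ n, 0 ≤ R n := fun n => Finset.sum_nonneg fun i _ => hD i
  -- The index of the cycle in progress at time `t`. The premise `0 ≤ t` sits inside the existential
  -- so that `choose` yields a function on all of `ℝ`.
  have hex : ∀ t : ℝ, ∃ n, 0 ≤ t → S n ≤ t ∧ t < S (n + 1) := by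
    intro t
    by_cases ht : 0 ≤ t
    · classical
      have hlt : ∃ n, t < S (n + 1) := by
        obtain ⟨n, hn⟩ := ((tendsto_add_atTop_iff_nat 1).2 hS |>.eventually_gt_atTop t).exists
        exact ⟨n, hn⟩
      refine ⟨Nat.find hlt, fun _ => ⟨?_, Nat.find_spec hlt⟩⟩
      rcases hk : Nat.find hlt with _ | k
      · simpa [hSdef] using ht
      · exact not_lt.1 (Nat.find_min hlt (m := k) (by omega))
    · exact ⟨0, fun h => absurd h ht⟩
  choose N hN using hex
  have hNtop : Tendsto N atTop atTop := by
    refine tendsto_atTop.2 fun m => ?_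
    filter_upwards [eventually_ge_atTop (S m), eventually_ge_atTop 0] with t ht ht0
    by_contra hlt
    have := hSmono (show N t + 1 ≤ m by omega)
    linarith [(hN t ht0).2]
  have hratio : Tendsto (fun n : ℕ => (n : ℝ) / (n + 1)) atTop (𝓝 1) :=
    tendsto_natCast_div_add_atTop 1
  -- The quotient factors as `(R n / n) * (n / (n + 1)) * ((n + 1) / S (n + 1))`; the upper bound is
  -- treated alike.
  have hlow : Tendsto (fun n => R n / S (n + 1)) atTop (𝓝 (d * γ)) := by
    have h1 := (hd.mul hratio).mul ((tendsto_add_atTop_iff_nat 1).2 hγ)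
    rw [mul_one] at h1
    refine h1.congr' ?_
    filter_upwards [eventually_gt_atTop 0] with n hn
    have : (0 : ℝ) < n := by exact_mod_cast hn
    push_cast
    field_simp
    rfl
  have hupp : Tendsto (fun n => R (n + 1) / S n) atTop (𝓝 (d * γ)) := by
    have h1 := (((tendsto_add_atTop_iff_nat 1).2 hd).mul (hratio.inv₀ one_ne_zero)).mul hγ
    rw [inv_one, mul_one] at h1
    refine h1.congr' ?_
    filter_upwards [eventually_gt_atTop 0] with n hn
    have : (0 : ℝ) < n := by exact_mod_cast hn
    push_cast
    field_simp
    rfl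
  have hSpos : ∀ᶠ t in atTop, 0 < S (N t) := hNtop.eventually (hS.eventually_gt_atTop 0)
  have hbound : ∀ t, 0 ≤ t → R (N t) ≤ x t ∧ x t ≤ R (N t + 1) := by
    intro t ht
    obtain ⟨h1, h2⟩ := hN t ht
    have hp := hx (N t) t
    rw [hRsucc]
    by_cases hw : t ≤ S (N t) + Tw (N t)
    · have : x t = R (N t) := hp.1 h1 hw
      rw [this]
      exact ⟨le_rfl, by linarith [hD (N t)]⟩
    · exact hp.2 (not_le.1 hw).le (by rw [hSsucc] at h2; exact h2)
  refine tendsto_of_tendsto_of_tendsto_of_le_of_le' (hlow.comp hNtop) (hupp.comp hNtop) ?_ ?_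
  · filter_upwards [eventually_gt_atTop 0] with t ht
    exact div_le_div₀ ((hR0 _).trans (hbound t ht.le).1) (hbound t ht.le).1 ht (hN t ht.le).2.le
  · filter_upwards [eventually_gt_atTop 0, hSpos] with t ht hpos
    exact div_le_div₀ (hR0 _) (hbound t ht.le).2 hpos (hN t ht.le).1

/-- The strong law of large numbers for nonnegative random variables of infinite mean. -/
theorem strong_law_ae_of_lintegral_eq_top {Ω : Type*} [MeasurableSpace Ω] {μ : Measure Ω}
    [IsProbabilityMeasure μ] {X : ℕ → Ω → ℝ} (hX0 : ∀ i, ∀ᵐ ω ∂μ, 0 ≤ X i ω)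
    (hindep : Pairwise fun i j => IndepFun (X i) (X j) μ)
    (hident : ∀ i, IdentDistrib (X i) (X 0) μ μ)
    (htop : ∫⁻ ω, ENNReal.ofReal (X 0 ω) ∂μ = ∞) :
    ∀ᵐ ω ∂μ, Tendsto (fun n : ℕ => (∑ i ∈ Finset.range n, X i ω) / n) atTop atTop := by
  -- The maximum with `0` makes the truncation bounded everywhere, while nonnegativity of the
  -- variables is only almost sure.
  set T : ℕ → ℝ → ℝ := fun M y => max 0 (min y M) with hT
  have hTm : ∀ M, Measurable (T M) := fun M => by fun_prop
  have hT0 : ∀ M y, 0 ≤ T M y := fun M y => le_max_left _ _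
  have hTM : ∀ M y, T M y ≤ M := fun M y => max_le (Nat.cast_nonneg M) (min_le_right _ _)
  have hmX : AEMeasurable (X 0) μ := (hident 0).aemeasurable_fst
  have hint : ∀ M, Integrable (fun ω => T M (X 0 ω)) μ := fun M =>
    Integrable.of_bound ((hTm M).comp_aemeasurable hmX).aestronglyMeasurable M
      (ae_of_all _ fun ω => by rw [Real.norm_of_nonneg (hT0 _ _)]; exact hTM _ _)
  have hmean : Tendsto (fun M => ∫ ω, T M (X 0 ω) ∂μ) atTop atTop := by
    have h1 : Tendsto (fun M => ∫⁻ ω, ENNReal.ofReal (T M (X 0 ω)) ∂μ) atTop (𝓝 ∞) := by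
      rw [← htop]
      refine lintegral_tendsto_of_tendsto_of_monotone
        (fun M => ((hTm M).comp_aemeasurable hmX).ennreal_ofReal) (ae_of_all _ fun ω => ?_) ?_
      · intro M M' hMM'
        refine ENNReal.ofReal_le_ofReal (max_le_max le_rfl (min_le_min le_rfl ?_))
        exact_mod_cast hMM'
      · filter_upwards [hX0 0] with ω hω
        refine tendsto_const_nhds.congr' ?_
        filter_upwards [eventually_ge_atTop ⌈X 0 ω⌉₊] with M hM
        rw [hT]
        simp only
        rw [min_eq_left ((Nat.le_ceil _).trans (by exact_mod_cast hM)), max_eq_right hω]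
    refine tendsto_atTop.2 fun b => ?_
    filter_upwards [h1.eventually (lt_mem_nhds (ENNReal.ofReal_lt_top (r := b)))] with M hM
    rw [← ofReal_integral_eq_lintegral_ofReal (hint M) (ae_of_all _ fun ω => hT0 _ _)] at hM
    by_contra hlt
    exact absurd hM (not_lt.2 (ENNReal.ofReal_le_ofReal (not_le.1 hlt).le))
  have hslln : ∀ M, ∀ᵐ ω ∂μ, Tendsto (fun n : ℕ => (∑ i ∈ Finset.range n, T M (X i ω)) / n) atTop
      (𝓝 (∫ ω, T M (X 0 ω) ∂μ)) := fun M =>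
    strong_law_ae_real (fun i ω => T M (X i ω)) (hint M)
      (fun i j hij => (hindep hij).comp (hTm M) (hTm M)) fun i => (hident i).comp (hTm M)
  -- Countably many truncation levels share one null set. Each truncated average is a lower bound,
  -- and its limit exceeds any `b` once `M` is large.
  filter_upwards [ae_all_iff.2 hslln, ae_all_iff.2 hX0] with ω hω hω0
  refine tendsto_atTop.2 fun b => ?_
  obtain ⟨M, hM⟩ := (hmean.eventually_gt_atTop b).exists
  filter_upwards [(hω M).eventually (lt_mem_nhds hM)] with n hn
  refine hn.le.trans (div_le_div_of_nonneg_right (Finset.sum_le_sum fun i _ => ?_)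
    (Nat.cast_nonneg n))
  exact max_le (hω0 i) (min_le_left _ _)

namespace HighwayIPS

/-- The null set comes from the strong laws alone and is fixed before the trajectory, so `x` may
depend on `ω` in any way, even without measurability. -/
theorem ae_tendsto_of_isPropagation {Ω : Type*} [MeasurableSpace Ω] {μ : Measure Ω}
    [IsProbabilityMeasure μ] {Tw Tt D : ℕ → Ω → ℝ} (hTw : ∀ i, ∀ᵐ ω ∂μ, 0 ≤ Tw i ω)
    (hTt : ∀ i, ∀ᵐ ω ∂μ, 0 ≤ Tt i ω) (hD : ∀ i, ∀ᵐ ω ∂μ, 0 ≤ D i ω)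
    (hindep : iIndepFun (fun i ω => (Tw i ω, Tt i ω, D i ω)) μ)
    (hident : ∀ i, IdentDistrib (fun ω => (Tw i ω, Tt i ω, D i ω))
      (fun ω => (Tw 0 ω, Tt 0 ω, D 0 ω)) μ μ)
    (hDint : Integrable (D 0) μ) {w : ℝ≥0∞} (hw : ∫⁻ ω, ENNReal.ofReal (Tw 0 ω) ∂μ = w)
    (hTtint : Integrable (Tt 0) μ) (hTtpos : 0 < ∫ ω, Tt 0 ω ∂μ) :
    ∀ᵐ ω ∂μ, ∀ x : ℝ → ℝ,
      IsPropagation (fun i => Tw i ω) (fun i => Tt i ω) (fun i => D i ω) x →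
      Tendsto (fun t : ℝ => ENNReal.ofReal (x t / t)) atTop
        (𝓝 (ENNReal.ofReal (∫ ω, D 0 ω ∂μ) / (w + ENNReal.ofReal (∫ ω, Tt 0 ω ∂μ)))) := by
  set C : ℕ → Ω → ℝ := fun i ω => Tw i ω + Tt i ω with hC
  have hmC : Measurable fun p : ℝ × ℝ × ℝ => p.1 + p.2.1 := by fun_prop
  have hmD : Measurable fun p : ℝ × ℝ × ℝ => p.2.2 := by fun_prop
  have hmW : Measurable fun p : ℝ × ℝ × ℝ => p.1 := by fun_prop
  have hC0 : ∀ i, ∀ᵐ ω ∂μ, 0 ≤ C i ω := fun i => by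
    filter_upwards [hTw i, hTt i] with ω h1 h2 using add_nonneg h1 h2
  have hCindep : Pairwise fun i j => IndepFun (C i) (C j) μ := fun i j hij =>
    (hindep.indepFun hij).comp hmC hmC
  have hCident : ∀ i, IdentDistrib (C i) (C 0) μ μ := fun i => (hident i).comp hmC
  have hDlim : ∀ᵐ ω ∂μ, Tendsto (fun n : ℕ => (∑ i ∈ Finset.range n, D i ω) / n) atTop
      (𝓝 (∫ ω, D 0 ω ∂μ)) :=
    strong_law_ae_real D hDint (fun i j hij => (hindep.indepFun hij).comp hmD hmD)
      fun i => (hident i).comp hmD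
  have hTwm : AEMeasurable (Tw 0) μ := ((hident 0).comp hmW).aemeasurable_fst
  rcases eq_or_ne w ∞ with rfl | hwtop
  · have hCtop : ∫⁻ ω, ENNReal.ofReal (C 0 ω) ∂μ = ∞ := by
      refine top_le_iff.1 (hw ▸ lintegral_mono_ae ?_)
      filter_upwards [hTt 0] with ω h2
      exact ENNReal.ofReal_le_ofReal (le_add_of_nonneg_right h2)
    filter_upwards [strong_law_ae_of_lintegral_eq_top hC0 hCindep hCident hCtop, hDlim,
      ae_all_iff.2 hTw, ae_all_iff.2 hTt, ae_all_iff.2 hD] with ω hCω hDω h1 h2 h3 x hx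
    -- Once the average duration exceeds `1`, the total duration of `n` cycles is at least `n`.
    have hS : Tendsto (fun n => ∑ i ∈ Finset.range n, (Tw i ω + Tt i ω)) atTop atTop := by
      refine tendsto_atTop_mono' _ ?_ tendsto_natCast_atTop_atTop
      filter_upwards [hCω.eventually_ge_atTop 1, eventually_gt_atTop 0] with n hn hn0
      have : (0 : ℝ) < n := by exact_mod_cast hn0
      exact (one_le_div this).1 hn
    have hγ : Tendsto (fun n : ℕ => n / ∑ i ∈ Finset.range n, (Tw i ω + Tt i ω)) atTop (𝓝 0) := by
      refine hCω.inv_tendsto_atTop.congr fun n => ?_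
      simp [hC, inv_div]
    have := ENNReal.tendsto_ofReal (hx.tendsto_div h1 h2 h3 hS hDω hγ)
    simpa using this
  · have hTwint : Integrable (Tw 0) μ := by
      refine ⟨hTwm.aestronglyMeasurable, ?_⟩
      rw [hasFiniteIntegral_iff_ofReal (hTw 0), hw]
      exact hwtop.lt_top
    have hwr : w = ENNReal.ofReal (∫ ω, Tw 0 ω ∂μ) := by
      rw [ofReal_integral_eq_lintegral_ofReal hTwint (hTw 0), hw]
    have hTw0 : 0 ≤ ∫ ω, Tw 0 ω ∂μ := integral_nonneg_of_ae (hTw 0)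
    have hCint : Integrable (C 0) μ := hTwint.add hTtint
    have hCmean : ∫ ω, C 0 ω ∂μ = ∫ ω, Tw 0 ω ∂μ + ∫ ω, Tt 0 ω ∂μ :=
      integral_add hTwint hTtint
    set c := ∫ ω, C 0 ω ∂μ with hc
    -- Positivity of the mean transmission time keeps the mean cycle length away from `0`, so the
    -- cycles exhaust all times.
    have hcpos : 0 < c := by rw [hCmean]; linarith
    filter_upwards [strong_law_ae_real C hCint hCindep hCident, hDlim,
      ae_all_iff.2 hTw, ae_all_iff.2 hTt, ae_all_iff.2 hD] with ω hCω hDω h1 h2 h3 x hx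
    have hS : Tendsto (fun n => ∑ i ∈ Finset.range n, (Tw i ω + Tt i ω)) atTop atTop := by
      refine (hCω.pos_mul_atTop hcpos tendsto_natCast_atTop_atTop).congr' ?_
      filter_upwards [eventually_gt_atTop 0] with n hn0
      have : (n : ℝ) ≠ 0 := by exact_mod_cast hn0.ne'
      exact div_mul_cancel₀ _ this
    have hγ : Tendsto (fun n : ℕ => n / ∑ i ∈ Finset.range n, (Tw i ω + Tt i ω)) atTop
        (𝓝 c⁻¹) := by
      refine (hCω.inv₀ hcpos.ne').congr fun n => ?_
      simp [hC, inv_div]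
    have := ENNReal.tendsto_ofReal (hx.tendsto_div h1 h2 h3 hS hDω hγ)
    rwa [← div_eq_mul_inv, ENNReal.ofReal_div_of_pos hcpos, hCmean,
      ENNReal.ofReal_add hTw0 hTtpos.le, ← hwr] at this

end HighwayIPS

/-! ### Assembly of the means and the limit. -/

theorem mainTheorem1 (h : Highway)
    (hlam : 0 < h.lam) (hv : 0 < h.v) (hr : 0 < h.r) (htau : 0 < h.tau)
    (hK : 0 < h.K) (hPt : 0 < h.Pt) (hPmin : 0 < h.Pmin) (hdel : 0 < h.del)
    (hPout0 : 0 < h.Pout) (hPout1 : h.Pout < 1)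
    (hrange : 0 < Real.sqrt h.V1 * normalQuantile h.Pout + h.M1) :
    IsGainFunction h.rangeGain ∧
    ∀ F : ℕ → ℝ, IsGainFunction F →
      ∀ {Ω : Type*} [MeasurableSpace Ω] (μ : Measure Ω) [IsProbabilityMeasure μ]
        (Tw Tt D : ℕ → Ω → ℝ),
        (∀ i, HasLaw (Tw i) (h.waitLaw F) μ) →
        (∀ i, HasLaw (Tt i) h.transmitLaw μ) →
        (∀ i, HasLaw (D i) (h.distanceLaw F) μ) →
        iIndepFun (fun i ω => (Tw i ω, Tt i ω, D i ω)) μ →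
        (∀ i, IdentDistrib (fun ω => (Tw i ω, Tt i ω, D i ω))
          (fun ω => (Tw 0 ω, Tt 0 ω, D 0 ω)) μ μ) →
        (∀ i, Integrable (D i) μ ∧ ∫ ω, D i ω ∂μ = h.meanDistance F) ∧
        (∀ i, ∫⁻ ω, ENNReal.ofReal (Tw i ω) ∂μ = h.meanWait F) ∧
        (∀ i, Integrable (Tt i) μ ∧ ∫ ω, Tt i ω ∂μ = h.meanTransmit) ∧
        ∀ᵐ ω ∂μ, ∀ x : ℝ → ℝ,
          IsPropagation (fun i => Tw i ω) (fun i => Tt i ω) (fun i => D i ω) x →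
          Tendsto (fun t : ℝ => ENNReal.ofReal (x t / t)) atTop (𝓝 (h.speed F)) := by

  refine ⟨Highway.isGainFunction_rangeGain hK hdel hPout0 hPout1 hrange, ?_⟩
  intro F hF Ω _ μ _ Tw Tt D hTw hTt hD hindep hident
  have hae : ∀ {X : Ω → ℝ} {L : Measure ℝ}, HasLaw X L μ → (∀ᵐ x ∂L, 0 ≤ x) →
      ∀ᵐ ω ∂μ, 0 ≤ X ω := fun hX h0 => ae_of_ae_map hX.aemeasurable (by rwa [hX.map_eq])
  have hDmean := fun i => integrable_and_integral_of_hasLaw (hD i)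
    (Highway.ae_distanceLaw_nonneg hlam) (Highway.meanDistance_pos hlam hr hF).le
    (Highway.lintegral_distanceLaw hlam hr hF)
  have hTtpos := Highway.meanTransmit_pos hlam hr htau hK hPt hPmin hdel
  have hTtmean := fun i => integrable_and_integral_of_hasLaw (hTt i)
    (Highway.ae_transmitLaw_nonneg htau) hTtpos.le
    (Highway.lintegral_transmitLaw hlam hr htau hK hPt hPmin hdel)
  have hTwmean : ∀ i, ∫⁻ ω, ENNReal.ofReal (Tw i ω) ∂μ = h.meanWait F := fun i => by
    rw [← Highway.lintegral_waitLaw hlam hr hv hF, ← (hTw i).map_eq,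
      lintegral_map' ENNReal.measurable_ofReal.aemeasurable (hTw i).aemeasurable]
  refine ⟨hDmean, hTwmean, hTtmean, ?_⟩
  have hlim := ae_tendsto_of_isPropagation
    (fun i => hae (hTw i) (Highway.ae_waitLaw_nonneg hlam hr hv hF))
    (fun i => hae (hTt i) (Highway.ae_transmitLaw_nonneg htau))
    (fun i => hae (hD i) (Highway.ae_distanceLaw_nonneg hlam)) hindep hident (hDmean 0).1
    (hTwmean 0) (hTtmean 0).1 (by rw [(hTtmean 0).2]; exact hTtpos)
  rwa [(hDmean 0).2, (hTtmean 0).2] at hlim
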